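/- Write $e(x)=\exp(2\pi i x)$ and let $\tau$ range over the upper half plane. Let $\eta(\tau)=e(\tau/24)\prod_{n\ge 1}(1-e(n\tau))$ be the Dedekind eta function. For $r\in\mathbb{Q}$ put $\eta^r(\tau)=\exp(r\log\eta(\tau))$, where $\log\eta(\tau)=\log\eta(i)+\int_i^\tau \frac{\eta'(z)}{\eta(z)}\,dz$ and $\log\eta(i)$ is the real logarithm of the positive number $\eta(i)$. Let $s(h,k)=\sum_{r \bmod k}\left(\left(\frac{r}{k}\right)\right)\left(\left(\frac{hr}{k}\right)\right)$ ($h\in\mathbb{Z}$, $k\in\mathbb{Z}_{\ge 1}$) be the Dedekind sum, where $((x))=x-\lfloor x\rfloor-\frac12$ for $x\in\mathbb{R}\setminus\mathbb{Z}$ and $((x))=0$ for $x\in\mathbb{Z}$. For a prime $p$, rationals $r_1,r_p$ with $(pr_1+r_p)/24\in\mathbb{Z}$, and a rational $k>2$ with $k\in\frac{r_1+r_p}{2}+2\mathbb{Z}$, put $$E^{1}_{k,p}(\tau;r_1,r_p)=\sum_{\substack{c>0,\ d\in\mathbb{Z}\\ \gcd(c,d)=\gcd(p,c)=1}}(c\tau+d)^{-k}\,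 e\!\left(-r_1\Big(\tfrac{a+b+d}{24(a+c)}+\tfrac12 s(-b-d,a+c)-\tfrac18\Big) -r_p\Big(\tfrac{a+b+d}{24(a+c)/p}+\tfrac12 s\big(-b-d,\tfrac{a+c}{p}\big)-\tfrac18\Big)\right),$$ where powers are taken with the principal branch and, for each pair $(c,d)$, $a$ and $b$ are any two integers with $ad-bc=1$, $p\mid a+c$ and $a+c>0$. Then the following holds, for every $\tau$ in the upper half plane and every choice of the integers $a,b$; in both cases the series converges absolutely. (1) If $n_\infty$ is a rational number with $\frac12<n_\infty\le 1$, then $$E^{1}_{4n_\infty,2}(\tau;-8n_\infty,16n_\infty)=2^{8n_\infty}\,\eta^{-8n_\infty}(\tau)\,\eta^{16n_\infty}(2\tau).$$ (2) If $n_\infty$ is a rational number with $\frac23<n_\infty\le 1$, then $$E^{1}_{3n_\infty,3}(\tau;-3n_\infty,9n_\infty)=3^{9n_\infty/2}\,e\!\left(-\frac{n_\infty}{4}\right)\eta^{-3n_\infty}(\tau)\,\eta^{9n_\infty}(3\tau).$$ -/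

import Mathlib

noncomputable section

namespace RatEis

/-- `e(x) = exp(2πix)`. -/
def e (x : ℂ) : ℂ := Complex.exp (2 * Real.pi * Complex.I * x)

/-- The sawtooth function: `((x)) = x - ⌊x⌋ - 1/2` if `x` is not an integer, and `0` otherwise. -/
def sawtooth (x : ℚ) : ℚ := if Int.fract x = 0 then 0 else x - ⌊x⌋ - 1 / 2

/-- The Dedekind sum `s(h, k)`, for an integer `h` and a positive integer `k`. -/
def dedekindSum (h k : ℤ) : ℚ :=
  ∑ r ∈ Finset.Ico (0 : ℤ) k, sawtooth ((r : ℚ) / k) * sawtooth ((h * r : ℚ) / k)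

/-- The holomorphic logarithm of the Dedekind eta function on the upper half plane,
`log η(i) + ∫_i^τ η'(z)/η(z) dz`, with the real logarithm of the real number `η(i)` and the
integral along the segment from `i` to `τ`. -/
def logEta (τ : ℂ) : ℂ :=
  (Real.log (ModularForm.eta Complex.I).re : ℂ) +
    ∫ t in (0 : ℝ)..1,
      logDeriv ModularForm.eta (Complex.I + t * (τ - Complex.I)) * (τ - Complex.I)

/-- The rational power `η^r(τ) = exp(r log η(τ))`. -/
def etaPow (r : ℚ) (τ : ℂ) : ℂ := Complex.exp (r * logEta τ)

/-- The pairs `(c, d)` of integers with `c > 0` and `gcd(c, d) = gcd(p, c) = 1`. -/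
def CuspPair (p : ℕ) : Type :=
  {x : ℤ × ℤ // 0 < x.1 ∧ IsCoprime x.1 x.2 ∧ IsCoprime (p : ℤ) x.1}

/-- A choice, for each pair `(c, d)`, of integers `a`, `b` such that `ad - bc = 1`, `p ∣ a + c` and
`a + c > 0`. -/
structure CuspLift (p : ℕ) where
  a : CuspPair p → ℤ
  b : CuspPair p → ℤ
  det_eq : ∀ x, a x * x.1.2 - b x * x.1.1 = 1
  dvd : ∀ x, (p : ℤ) ∣ a x + x.1.1
  pos : ∀ x, 0 < a x + x.1.1

/-- The exponent in the term of the Eisenstein series at the cusp `1` that belongs to the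
matrix with rows `(a, b)` and `(c, d)`. -/
def eisOnePhase (p : ℕ) (r₁ rₚ : ℚ) (a b c d : ℤ) : ℚ :=
  -r₁ * ((a + b + d : ℚ) / (24 * (a + c)) + 1 / 2 * dedekindSum (-b - d) (a + c) - 1 / 8)
    - rₚ * ((a + b + d : ℚ) / (24 * ((a + c) / p))
        + 1 / 2 * dedekindSum (-b - d) ((a + c) / p) - 1 / 8)

/-- The term of index `(c, d)` of the Eisenstein series at the cusp `1`. -/
def eisOneTerm (p : ℕ) (k r₁ rₚ : ℚ) (L : CuspLift p) (τ : ℂ) (x : CuspPair p) : ℂ :=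
  ((x.1.1 : ℂ) * τ + x.1.2) ^ (-(k : ℂ)) *
    e (eisOnePhase p r₁ rₚ (L.a x) (L.b x) x.1.1 x.1.2 : ℚ)

/-- The Eisenstein series `E¹_{k,p}(τ; r₁, rₚ)` at the cusp `1`, written with the choice `L` of the
integers `a`, `b`. -/
def eisOne (p : ℕ) (k r₁ rₚ : ℚ) (L : CuspLift p) (τ : ℂ) : ℂ :=
  ∑' x : CuspPair p, eisOneTerm p k r₁ rₚ L τ x

/-- Admissible choices of the integers `a`, `b` exist. -/
theorem nonempty_cuspLift (p : ℕ) (hp : 0 < p) : Nonempty (CuspLift p) := by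
  have key : ∀ x : CuspPair p, ∃ ab : ℤ × ℤ, ab.1 * x.1.2 - ab.2 * x.1.1 = 1 ∧
      (p : ℤ) ∣ ab.1 + x.1.1 ∧ 0 < ab.1 + x.1.1 := by
    rintro ⟨⟨c, d⟩, hc, ⟨u, v, huv⟩, ⟨w, z, hwz⟩⟩
    simp only at hc huv hwz ⊢
    have hp' : (0 : ℤ) < p := by exact_mod_cast hp
    have hfac : v + (-v * z + p * (|v * w| + 1) - 1) * c + c
        = p * (v * w + (|v * w| + 1) * c) := by
      linear_combination (-v) * hwz
    refine ⟨(v + (-v * z + p * (|v * w| + 1) - 1) * c,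
      -u + (-v * z + p * (|v * w| + 1) - 1) * d), ?_, ?_, ?_⟩
    · linear_combination huv
    · exact ⟨_, hfac⟩
    · rw [hfac]
      have h1 := neg_abs_le (v * w)
      have h2 : 0 ≤ |v * w| := abs_nonneg _
      exact mul_pos hp' (by nlinarith)
  choose f hf using key
  exact ⟨⟨fun x => (f x).1, fun x => (f x).2, fun x => (hf x).1, fun x => (hf x).2.1,
    fun x => (hf x).2.2⟩⟩

end RatEis

end

noncomputable section

namespace RatEis

theorem sawtooth_add_int (x : ℚ) (m : ℤ) : sawtooth (x + m) = sawtooth x := by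
  simp only [sawtooth, Int.fract_add_intCast, Int.floor_add_intCast]
  split_ifs <;> push_cast <;> ring

theorem sawtooth_neg (x : ℚ) : sawtooth (-x) = -sawtooth x := by
  simp only [sawtooth, Int.fract_neg_eq_zero]
  split_ifs with h
  · simp
  · have h1 : Int.fract (-x) = 1 - Int.fract x := Int.fract_neg h
    have h2 := Int.self_sub_floor x
    have h3 := Int.self_sub_floor (-x)
    linarith

theorem dedekindSum_neg (h k : ℤ) : dedekindSum (-h) k = -dedekindSum h k := by
  simp only [dedekindSum, ← Finset.sum_neg_distrib]
  refine Finset.sum_congr rfl fun r _ => ?_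
  rw [← mul_neg, ← sawtooth_neg]
  congr 2
  push_cast
  ring

theorem dedekindSum_add_mul (h k j : ℤ) : dedekindSum (h + j * k) k = dedekindSum h k := by
  simp only [dedekindSum]
  refine Finset.sum_congr rfl fun r hr => ?_
  have hk : (k : ℚ) ≠ 0 := by
    have := Finset.mem_Ico.mp hr
    exact_mod_cast (by lia : k ≠ 0)
  rw [← sawtooth_add_int ((h * r : ℚ) / k) (j * r)]
  congr 2
  push_cast
  field_simp

theorem dedekindSum_one (h : ℤ) : dedekindSum h 1 = 0 := by
  simp [dedekindSum, sawtooth]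


theorem sum_range_mul_mod {h k : ℕ} (hhk : h.Coprime k) (φ : ℕ → ℚ) :
    ∑ r ∈ Finset.range k, φ (h * r % k) = ∑ r ∈ Finset.range k, φ r := by
  have hinj : Set.InjOn (fun r => h * r % k) (Finset.range k) := by
    intro r hr s hs hrs
    simp only [Finset.coe_range, Set.mem_Iio] at hr hs
    have : r ≡ s [MOD k] := Nat.ModEq.cancel_left_of_coprime (Nat.Coprime.symm hhk) hrs
    rwa [Nat.ModEq, Nat.mod_eq_of_lt hr, Nat.mod_eq_of_lt hs] at this
  rw [← Finset.sum_image (f := φ) hinj]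
  congr 1
  refine Finset.eq_of_subset_of_card_le (fun x hx => ?_) (Finset.card_image_of_injOn hinj).ge
  obtain ⟨r, hr, rfl⟩ := Finset.mem_image.mp hx
  exact Finset.mem_range.mpr (Nat.mod_lt _ (Nat.zero_lt_of_lt (Finset.mem_range.mp hr)))

theorem sawtooth_natCast_div (m k : ℕ) :
    sawtooth ((m : ℚ) / k) =
      if ((m % k : ℕ) : ℚ) / k = 0 then 0 else ((m % k : ℕ) : ℚ) / k - 1 / 2 := by
  rw [sawtooth, Int.self_sub_floor, Int.fract_div_natCast_eq_div_natCast_mod]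

theorem sum_range_cast (k : ℕ) : ∑ r ∈ Finset.range k, (r : ℚ) = k * (k - 1) / 2 := by
  induction k with
  | zero => simp
  | succ k ih => rw [Finset.sum_range_succ, ih]; push_cast; ring

theorem sum_range_sq_cast (k : ℕ) :
    ∑ r ∈ Finset.range k, (r : ℚ) ^ 2 = k * (k - 1) * (2 * k - 1) / 6 := by
  induction k with
  | zero => simp
  | succ k ih => rw [Finset.sum_range_succ, ih]; push_cast; ring

theorem dedekindSum_natCast {h k : ℕ} (hk : 0 < k) (hhk : h.Coprime k) :
    dedekindSum h k =
      (∑ r ∈ Finset.range k, (r : ℚ) * ((h * r % k : ℕ) : ℚ)) / k ^ 2 - ((k : ℚ) - 1) / 4 := by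
  have hk0 : (k : ℚ) ≠ 0 := by exact_mod_cast hk.ne'
  have h1 : dedekindSum h k = ∑ r ∈ Finset.range k, (((r : ℚ) / k - 1 / 2) *
      (((h * r % k : ℕ) : ℚ) / k - 1 / 2) - if r = 0 then 1 / 4 else 0) := by
    rw [dedekindSum]
    have : Finset.Ico (0 : ℤ) k = (Finset.range k).image (fun r : ℕ => (r : ℤ)) := by
      ext x
      simp only [Finset.mem_Ico, Finset.mem_image, Finset.mem_range]
      constructor
      · rintro ⟨h0, h1⟩
        exact ⟨x.toNat, by lia, by lia⟩
      · rintro ⟨r, hr, rfl⟩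
        lia
    rw [this, Finset.sum_image (fun _ _ _ _ h => by exact_mod_cast h)]
    refine Finset.sum_congr rfl fun r hr => ?_
    have hr := Finset.mem_range.mp hr
    have e1 := sawtooth_natCast_div r k
    have e2 := sawtooth_natCast_div (h * r) k
    push_cast at e1 e2 ⊢
    rw [e1, e2]
    rcases Nat.eq_zero_or_pos r with rfl | hr0
    · norm_num
    · have hne : ((h * r % k : ℕ) : ℚ) ≠ 0 := by
        norm_cast
        intro h0
        have := (Nat.Coprime.symm hhk).dvd_of_dvd_mul_left (Nat.dvd_of_mod_eq_zero h0)
        exact absurd (Nat.le_of_dvd hr0 this) (by lia)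
      have hr1 : (r : ℚ) ≠ 0 := by exact_mod_cast hr0.ne'
      simp [Nat.mod_eq_of_lt hr, hne, hr1, hr0.ne', hk0]
  have h2 := sum_range_mul_mod hhk (fun r => (r : ℚ))
  have h3 := sum_range_cast k
  have h4 : ∑ r ∈ Finset.range k, (((r : ℚ) / k - 1 / 2) *
      (((h * r % k : ℕ) : ℚ) / k - 1 / 2) - if r = 0 then 1 / 4 else 0) =
      (∑ r ∈ Finset.range k, (r : ℚ) * ((h * r % k : ℕ) : ℚ)) / k ^ 2
      - (∑ r ∈ Finset.range k, (r : ℚ)) / (2 * k)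
      - (∑ r ∈ Finset.range k, ((h * r % k : ℕ) : ℚ)) / (2 * k) + k / 4 - 1 / 4 := by
    rw [Finset.sum_sub_distrib, Finset.sum_ite_eq' (Finset.range k) 0]
    simp only [Finset.mem_range, hk, if_true, Finset.sum_div]
    rw [← Finset.sum_sub_distrib, ← Finset.sum_sub_distrib]
    have : (k : ℚ) / 4 = ∑ r ∈ Finset.range k, (1 / 4 : ℚ) := by
      simp [div_eq_mul_inv]
    rw [this, ← Finset.sum_add_distrib]
    congr 1
    refine Finset.sum_congr rfl fun r _ => ?_
    field_simp
    ring
  rw [h1, h4, h2, h3]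
  field_simp
  ring

/-- Counting lattice points below the diagonal of a rectangle, weighted by height. -/
theorem sum_range_div_mul_succ {h k : ℕ} (hh : 0 < h) (hk : 0 < k) (hhk : h.Coprime k) :
    ∑ r ∈ Finset.range k, ((h * r / k : ℕ) : ℚ) * (((h * r / k : ℕ) : ℚ) + 1) =
      2 * ∑ v ∈ Finset.range h, (v : ℚ) * ((k : ℚ) - 1 - ((k * v / h : ℕ) : ℚ)) := by
  have h1 : ∀ r ∈ Finset.range k, ((h * r / k : ℕ) : ℚ) * (((h * r / k : ℕ) : ℚ) + 1) =
      2 * ∑ v ∈ Finset.range h, if v * k ≤ h * r then (v : ℚ) else 0 := by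
    intro r hr
    have hr := Finset.mem_range.mp hr
    have hlt : h * r / k < h := by
      rw [Nat.div_lt_iff_lt_mul hk]
      exact Nat.mul_lt_mul_of_pos_left hr hh
    rw [← Finset.sum_filter]
    have : (Finset.range h).filter (fun v => v * k ≤ h * r) = Finset.range (h * r / k + 1) := by
      ext v
      simp only [Finset.mem_filter, Finset.mem_range, Nat.lt_succ_iff, Nat.le_div_iff_mul_le hk]
      refine ⟨fun h => h.2, fun h' => ⟨?_, h'⟩⟩
      exact lt_of_le_of_lt ((Nat.le_div_iff_mul_le hk).mpr h') hlt
    rw [this, sum_range_cast]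
    push_cast
    ring
  rw [Finset.sum_congr rfl h1, ← Finset.mul_sum, Finset.sum_comm]
  congr 1
  refine Finset.sum_congr rfl fun v hv => ?_
  have hv := Finset.mem_range.mp hv
  rcases Nat.eq_zero_or_pos v with rfl | hv0
  · simp
  · rw [← Finset.sum_filter, Finset.sum_const, nsmul_eq_mul, mul_comm]
    have hlt : k * v / h < k := by
      rw [Nat.div_lt_iff_lt_mul hh]
      exact Nat.mul_lt_mul_of_pos_left hv hk
    have : (Finset.range k).filter (fun r => v * k ≤ h * r) = Finset.Ioo (k * v / h) k := by
      ext r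
      simp only [Finset.mem_filter, Finset.mem_range, Finset.mem_Ioo, Nat.div_lt_iff_lt_mul hh]
      have hne : k * v ≠ r * h := fun h0 => by
        have := hhk.dvd_of_dvd_mul_left (Dvd.intro_left r h0.symm)
        exact absurd (Nat.le_of_dvd hv0 this) (by lia)
      rw [mul_comm v k, mul_comm h r]
      constructor
      · rintro ⟨h1, h2⟩
        exact ⟨lt_of_le_of_ne h2 hne, h1⟩
      · rintro ⟨h1, h2⟩
        exact ⟨h2, h1.le⟩
    rw [this, Nat.card_Ioo, Nat.sub_sub, Nat.cast_sub (by lia)]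
    push_cast
    ring

/-- The reciprocity law for Dedekind sums. -/
theorem dedekindSum_reciprocity {h k : ℕ} (hh : 0 < h) (hk : 0 < k) (hhk : h.Coprime k) :
    dedekindSum h k + dedekindSum k h =
      -1 / 4 + ((h : ℚ) ^ 2 + (k : ℚ) ^ 2 + 1) / (12 * h * k) := by
  have hk0 : (k : ℚ) ≠ 0 := by exact_mod_cast hk.ne'
  have hh0 : (h : ℚ) ≠ 0 := by exact_mod_cast hh.ne'
  have hmod : ∀ a b c : ℕ, ((a * c % b : ℕ) : ℚ) = a * c - b * ((a * c / b : ℕ) : ℚ) := by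
    intro a b c
    have := Nat.mod_add_div (a * c) b
    have : ((a * c % b : ℕ) : ℚ) + b * ((a * c / b : ℕ) : ℚ) = a * c := by exact_mod_cast this
    linarith
  have hprod : ∀ a b : ℕ, ∑ r ∈ Finset.range b, (r : ℚ) * ((a * r % b : ℕ) : ℚ) =
      a * ∑ r ∈ Finset.range b, (r : ℚ) ^ 2
        - b * ∑ r ∈ Finset.range b, (r : ℚ) * ((a * r / b : ℕ) : ℚ) := by
    intro a b
    rw [Finset.mul_sum, Finset.mul_sum, ← Finset.sum_sub_distrib]
    refine Finset.sum_congr rfl fun r _ => ?_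
    rw [hmod]
    ring
  have hlin := sum_range_mul_mod hhk (fun r => (r : ℚ))
  have hsq := sum_range_mul_mod hhk (fun r => (r : ℚ) ^ 2)
  have hcount := sum_range_div_mul_succ hh hk hhk
  have hlin' : ∑ r ∈ Finset.range k, ((h * r % k : ℕ) : ℚ) =
      h * ∑ r ∈ Finset.range k, (r : ℚ) - k * ∑ r ∈ Finset.range k, ((h * r / k : ℕ) : ℚ) := by
    rw [Finset.mul_sum, Finset.mul_sum, ← Finset.sum_sub_distrib]
    exact Finset.sum_congr rfl fun r _ => hmod h k r
  have hsq' : ∑ r ∈ Finset.range k, ((h * r % k : ℕ) : ℚ) ^ 2 =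
      h ^ 2 * ∑ r ∈ Finset.range k, (r : ℚ) ^ 2
        - 2 * h * k * ∑ r ∈ Finset.range k, (r : ℚ) * ((h * r / k : ℕ) : ℚ)
        + k ^ 2 * ∑ r ∈ Finset.range k, ((h * r / k : ℕ) : ℚ) ^ 2 := by
    rw [Finset.mul_sum, Finset.mul_sum, Finset.mul_sum, ← Finset.sum_sub_distrib,
      ← Finset.sum_add_distrib]
    refine Finset.sum_congr rfl fun r _ => ?_
    rw [hmod]
    ring
  have hcl : ∑ r ∈ Finset.range k, ((h * r / k : ℕ) : ℚ) * (((h * r / k : ℕ) : ℚ) + 1) =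
      ∑ r ∈ Finset.range k, ((h * r / k : ℕ) : ℚ) ^ 2
        + ∑ r ∈ Finset.range k, ((h * r / k : ℕ) : ℚ) := by
    rw [← Finset.sum_add_distrib]
    exact Finset.sum_congr rfl fun r _ => by ring
  have hcr : ∑ v ∈ Finset.range h, (v : ℚ) * ((k : ℚ) - 1 - ((k * v / h : ℕ) : ℚ)) =
      (k - 1) * ∑ v ∈ Finset.range h, (v : ℚ)
        - ∑ v ∈ Finset.range h, (v : ℚ) * ((k * v / h : ℕ) : ℚ) := by
    rw [Finset.mul_sum, ← Finset.sum_sub_distrib]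
    exact Finset.sum_congr rfl fun r _ => by ring
  rw [dedekindSum_natCast hk hhk, dedekindSum_natCast hh hhk.symm, hprod, hprod]
  rw [hlin'] at hlin
  rw [hsq'] at hsq
  rw [hcl, hcr] at hcount
  simp only [sum_range_cast, sum_range_sq_cast] at *
  generalize ∑ r ∈ Finset.range k, (r : ℚ) * ((h * r / k : ℕ) : ℚ) = A at *
  generalize ∑ v ∈ Finset.range h, (v : ℚ) * ((k * v / h : ℕ) : ℚ) = B at *
  generalize ∑ r ∈ Finset.range k, ((h * r / k : ℕ) : ℚ) ^ 2 = M at *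
  generalize ∑ r ∈ Finset.range k, ((h * r / k : ℕ) : ℚ) = N at *
  have hN : N = (h - 1) * (k - 1) / 2 := by
    apply mul_left_cancel₀ hk0
    linear_combination -hlin
  have hB : B = (k - 1) * (h * (h - 1) / 2) - (M + N) / 2 := by linear_combination hcount / 2
  have hA : A = (h ^ 2 * (k * (k - 1) * (2 * k - 1) / 6) + k ^ 2 * M
      - (k * (k - 1) * (2 * k - 1) / 6)) / (2 * h * k) := by
    rw [eq_div_iff (by simp [hh0, hk0])]
    linear_combination -hsq
  rw [hB, hA, hN]
  field_simp
  ring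

end RatEis

namespace RatEis

open Complex Filter Topology
open UpperHalfPlane (upperHalfPlaneSet)
open Function.Periodic (qParam)

/-- The series `∑ log (1 - q ^ n)`, a logarithm of Euler's product on the unit disc. -/
def logEuler (q : ℂ) : ℂ := ∑' n : ℕ, log (1 - q ^ (n + 1))

theorem norm_log_one_sub_pow_le {q : ℂ} {ρ : ℝ} (hq : ‖q‖ ≤ ρ) (hρ : ρ < 1) (n : ℕ) :
    ‖log (1 - q ^ (n + 1))‖ ≤ ((1 - ρ)⁻¹ + 1) * ρ ^ (n + 1) := by
  have hρ0 : 0 ≤ ρ := (norm_nonneg _).trans hq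
  have h1 : ‖-q ^ (n + 1)‖ ≤ ρ ^ (n + 1) := by
    rw [norm_neg, norm_pow]
    exact pow_le_pow_left₀ (norm_nonneg _) hq _
  have h2 : ρ ^ (n + 1) ≤ ρ := by
    simpa using pow_le_pow_of_le_one hρ0 hρ.le (Nat.le_add_left 1 n)
  have h3 := Complex.norm_log_one_add_le (h1.trans_lt (h2.trans_lt hρ))
  rw [← sub_eq_add_neg] at h3
  refine h3.trans ?_
  set x := ‖-q ^ (n + 1)‖
  have hx0 : 0 ≤ x := norm_nonneg _
  have h4 : (1 - x)⁻¹ ≤ (1 - ρ)⁻¹ := inv_anti₀ (by linarith) (by linarith)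
  have h5 : 0 ≤ (1 - x)⁻¹ := inv_nonneg.mpr (by linarith)
  have h6 : x ^ 2 ≤ x := by nlinarith
  have h7 : x ^ 2 * (1 - x)⁻¹ ≤ x * (1 - ρ)⁻¹ := mul_le_mul h6 h4 h5 hx0
  have h8 : 0 ≤ (1 - ρ)⁻¹ := inv_nonneg.mpr (by linarith)
  have h9 : x * (1 - ρ)⁻¹ ≤ ρ ^ (n + 1) * (1 - ρ)⁻¹ := mul_le_mul_of_nonneg_right h1 h8
  nlinarith [mul_nonneg hx0 h8]

theorem one_sub_pow_mem_slitPlane {q : ℂ} (hq : ‖q‖ < 1) (n : ℕ) :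
    1 - q ^ (n + 1) ∈ slitPlane := by
  rw [sub_eq_add_neg]
  apply mem_slitPlane_of_norm_lt_one
  rw [norm_neg, norm_pow]
  exact pow_lt_one₀ (norm_nonneg _) hq (by simp)

theorem differentiableOn_logEuler : DifferentiableOn ℂ logEuler (Metric.ball 0 1) := by
  intro q hq
  rw [mem_ball_zero_iff] at hq
  obtain ⟨ρ, h1, h2⟩ := exists_between hq
  have hρ0 : 0 ≤ ρ := (norm_nonneg _).trans h1.le
  refine (DifferentiableOn.differentiableAt (s := Metric.ball 0 ρ) ?_
    (Metric.isOpen_ball.mem_nhds (by simpa using h1))).differentiableWithinAt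
  refine differentiableOn_tsum_of_summable_norm (u := fun n : ℕ => ((1 - ρ)⁻¹ + 1) * ρ ^ (n + 1))
    (((summable_nat_add_iff 1).mpr (summable_geometric_of_lt_one hρ0 h2)).mul_left _) ?_
    Metric.isOpen_ball ?_
  · intro n w hw
    rw [mem_ball_zero_iff] at hw
    refine DifferentiableAt.differentiableWithinAt ?_
    refine DifferentiableAt.clog (by fun_prop) ?_
    exact one_sub_pow_mem_slitPlane (hw.trans h2) n
  · intro n w hw
    rw [mem_ball_zero_iff] at hw
    exact norm_log_one_sub_pow_le hw.le h2 n

theorem logEuler_zero : logEuler 0 = 0 := by simp [logEuler]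

theorem exp_logEuler {q : ℂ} (hq : ‖q‖ < 1) : exp (logEuler q) = ∏' n : ℕ, (1 - q ^ (n + 1)) := by
  refine cexp_tsum_eq_tprod (fun n => slitPlane_ne_zero (one_sub_pow_mem_slitPlane hq n)) ?_
  refine Summable.of_norm_bounded
    (((summable_nat_add_iff 1).mpr (summable_geometric_of_lt_one (norm_nonneg q) hq)).mul_left
      ((1 - ‖q‖)⁻¹ + 1)) fun n => norm_log_one_sub_pow_le le_rfl hq n

theorem logEuler_ofReal_im {x : ℝ} (hx : |x| < 1) : (logEuler x).im = 0 := by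
  have : logEuler x = ((∑' n : ℕ, Real.log (1 - x ^ (n + 1)) : ℝ) : ℂ) := by
    rw [ofReal_tsum, logEuler]
    refine tsum_congr fun n => ?_
    have : |x ^ (n + 1)| < 1 := by
      rw [abs_pow]
      exact pow_lt_one₀ (abs_nonneg _) hx (by simp)
    rw [ofReal_log (by linarith [le_abs_self (x ^ (n + 1))])]
    push_cast
    rfl
  rw [this, ofReal_im]

theorem norm_qParam_one_lt {τ : ℂ} (hτ : 0 < τ.im) : ‖qParam 1 τ‖ < 1 := by
  simpa using UpperHalfPlane.norm_qParam_lt_one 1 ⟨τ, hτ⟩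

/-- The logarithm of the Dedekind eta function given by the product expansion. -/
def etaLog (τ : ℂ) : ℂ := Real.pi * I * τ / 12 + logEuler (qParam 1 τ)

theorem differentiableOn_etaLog : DifferentiableOn ℂ etaLog upperHalfPlaneSet := by
  refine DifferentiableOn.add (by fun_prop) ?_
  exact differentiableOn_logEuler.comp (by fun_prop)
    fun τ hτ => by simpa using norm_qParam_one_lt hτ

theorem exp_etaLog {τ : ℂ} (hτ : 0 < τ.im) : exp (etaLog τ) = ModularForm.eta τ := by
  rw [etaLog, exp_add, exp_logEuler (norm_qParam_one_lt hτ), ModularForm.eta]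
  congr 1
  rw [qParam]
  congr 1
  push_cast
  ring

theorem hasDerivAt_etaLog {τ : ℂ} (hτ : 0 < τ.im) :
    HasDerivAt etaLog (logDeriv ModularForm.eta τ) τ := by
  have hU : upperHalfPlaneSet ∈ 𝓝 τ := UpperHalfPlane.isOpen_upperHalfPlaneSet.mem_nhds hτ
  have h1 := (differentiableOn_etaLog.differentiableAt hU).hasDerivAt
  have h2 : ModularForm.eta =ᶠ[𝓝 τ] fun z => exp (etaLog z) := by
    filter_upwards [hU] with z hz using (exp_etaLog hz).symm
  have h3 : logDeriv ModularForm.eta τ = deriv etaLog τ := by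
    rw [logDeriv_apply, h2.deriv_eq, h1.cexp.deriv, ← exp_etaLog hτ]
    field_simp [exp_ne_zero]
  rwa [h3]

theorem etaLog_I : etaLog I = (Real.log (ModularForm.eta I).re : ℂ) := by
  have him : (etaLog I).im = 0 := by
    have hq : qParam 1 I = ((Real.exp (-(2 * Real.pi)) : ℝ) : ℂ) := by
      rw [qParam, ofReal_exp]
      congr 1
      push_cast
      linear_combination (2 * Real.pi : ℂ) * I_mul_I
    have h1 : |Real.exp (-(2 * Real.pi))| < 1 := by
      rw [abs_of_pos (Real.exp_pos _), Real.exp_lt_one_iff]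
      linarith [Real.pi_pos]
    rw [etaLog, hq, add_im, logEuler_ofReal_im h1,
      show (Real.pi * I * I / 12 : ℂ) = ((-Real.pi / 12 : ℝ) : ℂ) by
        push_cast; linear_combination (Real.pi / 12 : ℂ) * I_mul_I, ofReal_im, add_zero]
  have hre : etaLog I = ((etaLog I).re : ℂ) := by
    apply Complex.ext <;> simp [him]
  have h2 : (ModularForm.eta I).re = Real.exp (etaLog I).re := by
    rw [← exp_etaLog (by simp), hre, ← ofReal_exp, ofReal_re, ofReal_re]
  rw [h2, Real.log_exp, ← hre]

theorem logEta_eq_etaLog {τ : ℂ} (hτ : 0 < τ.im) : logEta τ = etaLog τ := by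
  have hseg : ∀ t ∈ Set.Icc (0 : ℝ) 1, 0 < (I + t • (τ - I)).im := by
    intro t ht
    have : (I + t • (τ - I)).im = (1 - t) + t * τ.im := by
      simp
      ring
    rw [this]
    rcases ht.1.eq_or_lt with h0 | h0
    · rw [← h0]; norm_num
    · have := ht.2
      nlinarith [mul_pos h0 hτ]
  have hcont : ContinuousOn (logDeriv ModularForm.eta) upperHalfPlaneSet :=
    (differentiableOn_etaLog.deriv UpperHalfPlane.isOpen_upperHalfPlaneSet).continuousOn.congr
      fun z hz => (hasDerivAt_etaLog hz).deriv.symm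
  have h1 := intervalIntegral.integral_unitInterval_deriv_eq_sub (𝕜 := ℂ) (f := etaLog)
    (f' := logDeriv ModularForm.eta) (z₀ := I) (z₁ := τ - I)
    (hcont.comp (by fun_prop) hseg) (fun t ht => hasDerivAt_etaLog (hseg t ht))
  rw [add_sub_cancel, etaLog_I, smul_eq_mul, mul_comm, ← intervalIntegral.integral_mul_const] at h1
  rw [logEta]
  simp only [real_smul] at h1
  rw [h1]
  ring

theorem exp_logEta {τ : ℂ} (hτ : 0 < τ.im) : exp (logEta τ) = ModularForm.eta τ := by
  rw [logEta_eq_etaLog hτ, exp_etaLog hτ]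

theorem differentiableOn_logEta : DifferentiableOn ℂ logEta upperHalfPlaneSet :=
  differentiableOn_etaLog.congr fun _ hz => logEta_eq_etaLog hz

theorem logEta_add_int {τ : ℂ} (hτ : 0 < τ.im) (m : ℤ) :
    logEta (τ + m) = logEta τ + Real.pi * I * m / 12 := by
  have h : 0 < (τ + m).im := by simpa using hτ
  rw [logEta_eq_etaLog h, logEta_eq_etaLog hτ, etaLog, etaLog]
  have : qParam 1 (τ + m) = qParam 1 τ := by
    rw [qParam, qParam, exp_eq_exp_iff_exists_int]
    exact ⟨m, by push_cast; ring⟩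
  rw [this]
  ring

theorem im_neg_inv_pos {τ : ℂ} (hτ : 0 < τ.im) : 0 < (-1 / τ).im := by
  rw [neg_div, one_div, neg_im, inv_im, neg_div, neg_neg]
  exact div_pos hτ (normSq_pos.mpr (by rintro rfl; simp at hτ))

theorem logEta_neg_inv {τ : ℂ} (hτ : 0 < τ.im) :
    logEta (-1 / τ) = logEta τ + log τ / 2 - Real.pi * I / 4 := by
  have hne : ∀ z ∈ upperHalfPlaneSet, z ≠ 0 := by
    rintro z hz rfl
    simp [upperHalfPlaneSet] at hz
  have hslit : ∀ z ∈ upperHalfPlaneSet, z ∈ slitPlane := fun z hz => Or.inr (ne_of_gt hz)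
  let Ψ : ℂ → ℂ := fun z => logEta (-1 / z) - logEta z - log z / 2
  have hd : DifferentiableOn ℂ Ψ upperHalfPlaneSet := by
    refine ((differentiableOn_logEta.comp (t := upperHalfPlaneSet) ?_ ?_).sub
      differentiableOn_logEta).sub (DifferentiableOn.div_const ?_ _)
    · exact DifferentiableOn.div (by fun_prop) (by fun_prop) hne
    · exact fun z hz => im_neg_inv_pos hz
    · exact fun z hz => (differentiableAt_log (hslit z hz)).differentiableWithinAt
  have hexp : ∀ z ∈ upperHalfPlaneSet, exp (Ψ z) = (sqrt I)⁻¹ := by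
    intro z hz
    have h1 := ModularForm.eta_comp_eq_csqrt_I_inv hz
    simp only [Function.comp_apply, Pi.smul_apply, Pi.mul_apply, smul_eq_mul] at h1
    simp only [Ψ]
    rw [exp_sub, exp_sub, exp_logEta (im_neg_inv_pos hz), exp_logEta hz, h1,
      sqrt_eq_exp (hne z hz)]
    have := ModularForm.eta_ne_zero hz
    field_simp [exp_ne_zero]
  have hderiv : Set.EqOn (deriv Ψ) 0 upperHalfPlaneSet := by
    intro z hz
    have hU := UpperHalfPlane.isOpen_upperHalfPlaneSet.mem_nhds hz
    have h1 := (hd.differentiableAt hU).hasDerivAt.cexp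
    have h2 : (fun z => exp (Ψ z)) =ᶠ[𝓝 z] fun _ => (sqrt I)⁻¹ := by
      filter_upwards [hU] with w hw using hexp w hw
    have h3 := h1.deriv
    rw [h2.deriv_eq, deriv_const] at h3
    exact (mul_eq_zero.mp h3.symm).resolve_left (exp_ne_zero _)
  have hc := UpperHalfPlane.isOpen_upperHalfPlaneSet.is_const_of_deriv_eq_zero
    (Convex.isPreconnected (convex_halfSpace_im_gt 0)) hd hderiv
    (show τ ∈ upperHalfPlaneSet from hτ) (show I ∈ upperHalfPlaneSet by simp [upperHalfPlaneSet])
  simp only [Ψ] at hc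
  rw [show -1 / I = I by rw [div_I]; ring, log_I] at hc
  linear_combination hc

theorem tendsto_logEta_sub :
    Tendsto (fun τ : ℂ => logEta τ - Real.pi * I * τ / 12) (comap im atTop) (𝓝 0) := by
  have h1 : Tendsto logEuler (𝓝[≠] 0) (𝓝 0) := by
    have := (differentiableOn_logEuler.differentiableAt
      (Metric.isOpen_ball.mem_nhds (Metric.mem_ball_self one_pos))).continuousAt.tendsto
    rw [logEuler_zero] at this
    exact this.mono_left nhdsWithin_le_nhds
  refine (h1.comp (Function.Periodic.qParam_tendsto one_pos)).congr' ?_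
  filter_upwards [preimage_mem_comap (Ioi_mem_atTop (0 : ℝ))] with τ hτ
  rw [logEta_eq_etaLog hτ, etaLog, Function.comp_apply]
  ring

end RatEis

namespace RatEis

open Complex

theorem arg_pos_of_im_pos {x : ℂ} (hx : 0 < x.im) : 0 < x.arg := by
  refine lt_of_le_of_ne (arg_nonneg_iff.mpr hx.le) fun h => ?_
  exact hx.ne' (arg_eq_zero_iff.mp h.symm).2

theorem exp_log_add_log {x y : ℂ} (hx : 0 < x.im) (hy : 0 < y.im) :
    exp (log x + log y) = x * y := by
  rw [exp_add, exp_log (by rintro rfl; simp at hx), exp_log (by rintro rfl; simp at hy)]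

theorem log_mul_of_im_pos {x y : ℂ} (hx : 0 < x.im) (hy : 0 < y.im) (hxy : 0 < (x * y).im) :
    log (x * y) = log x + log y := by
  have h1 := arg_pos_of_im_pos hx
  have h2 := arg_pos_of_im_pos hy
  rw [← exp_log_add_log hx hy, log_exp]
  · rw [add_im, log_im, log_im]
    linarith [Real.pi_pos]
  · by_contra! h
    rw [← exp_log_add_log hx hy, exp_im] at hxy
    have h3 := pos_of_mul_pos_right hxy (Real.exp_pos _).le
    rw [add_im, log_im, log_im] at h h3
    have h4 : 0 ≤ Real.sin (x.arg + y.arg - Real.pi) :=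
      Real.sin_nonneg_of_nonneg_of_le_pi (by linarith) (by linarith [arg_le_pi x, arg_le_pi y])
    rw [Real.sin_sub_pi] at h4
    linarith

theorem log_neg_mul_of_im_pos {x y : ℂ} (hx : 0 < x.im) (hy : 0 < y.im) :
    log (-(x * y)) = log x + log y - Real.pi * I := by
  have h1 := arg_pos_of_im_pos hx
  have h2 := arg_pos_of_im_pos hy
  have h3 : -(x * y) = exp (log x + log y - Real.pi * I) := by
    rw [exp_sub, exp_log_add_log hx hy, exp_pi_mul_I]
    ring
  have h4 : (log x + log y - Real.pi * I).im = x.arg + y.arg - Real.pi := by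
    simp [log_im]
  rw [h3, log_exp]
  · rw [h4]; linarith
  · rw [h4]; linarith [arg_le_pi x, arg_le_pi y]

theorem denom_ne_zero {C D : ℤ} (hCD : IsCoprime C D) {τ : ℂ} (hτ : 0 < τ.im) :
    (C : ℂ) * τ + D ≠ 0 := by
  intro h
  have h1 := congrArg im h
  have h2 := congrArg re h
  simp at h1 h2
  have hC : C = 0 := h1.resolve_right hτ.ne'
  subst hC
  have : D = 0 := by simpa using h2
  subst this
  obtain ⟨u, v, huv⟩ := hCD
  simp at huv

theorem isCoprime_of_det {A B C D : ℤ} (hdet : A * D - B * C = 1) : IsCoprime C D :=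
  ⟨-B, A, by linear_combination hdet⟩

theorem im_moebius {A B C D : ℤ} (hdet : A * D - B * C = 1) (τ : ℂ) :
    ((A * τ + B) / (C * τ + D)).im = τ.im / normSq (C * τ + D) := by
  have h : (A : ℝ) * D - B * C = 1 := by exact_mod_cast hdet
  rw [div_im, ← sub_div]
  congr 1
  simp
  linear_combination τ.im * h

theorem im_moebius_pos {A B C D : ℤ} (hdet : A * D - B * C = 1) {τ : ℂ} (hτ : 0 < τ.im) :
    0 < ((A * τ + B) / (C * τ + D)).im := by
  rw [im_moebius hdet]
  exact div_pos hτ (normSq_pos.mpr (denom_ne_zero (isCoprime_of_det hdet) hτ))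

theorem im_denom_pos {C D : ℤ} (hC : 0 < C) {τ : ℂ} (hτ : 0 < τ.im) :
    0 < ((C : ℂ) * τ + D).im := by
  have : (0 : ℝ) < C := by exact_mod_cast hC
  simpa using mul_pos this hτ

/-- Dedekind's transformation formula for the logarithm of the eta function, for a fixed
matrix. -/
def DedekindFormula (A B C D : ℤ) : Prop :=
  ∀ τ : ℂ, 0 < τ.im → logEta ((A * τ + B) / (C * τ + D)) =
    logEta τ + log (C * τ + D) / 2 - Real.pi * I / 4
      + 2 * Real.pi * I * (((A + D : ℚ) / (24 * C) - dedekindSum D C / 2 : ℚ) : ℂ)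

theorem DedekindFormula.of_translate {A B C D : ℤ} (hC : 0 < C) (j : ℤ)
    (h : DedekindFormula A (B + j * A) C (D + j * C)) : DedekindFormula A B C D := by
  intro τ hτ
  have hτ' : 0 < (τ - j).im := by simpa using hτ
  have hC0 : (C : ℂ) ≠ 0 := by exact_mod_cast hC.ne'
  have h1 := h (τ - j) hτ'
  rw [dedekindSum_add_mul] at h1
  have h2 := logEta_add_int hτ' j
  rw [sub_add_cancel] at h2
  push_cast at h1 ⊢
  rw [show (A : ℂ) * (τ - j) + (B + j * A) = A * τ + B by ring,
    show (C : ℂ) * (τ - j) + (D + j * C) = C * τ + D by ring] at h1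
  rw [h1, h2]
  field_simp
  ring

theorem dedekindFormula_one {A B D : ℤ} (hdet : A * D - B * 1 = 1) :
    DedekindFormula A B 1 D := by
  intro τ hτ
  have hτ' : 0 < (τ + D).im := by simpa using hτ
  have hne : τ + D ≠ 0 := by intro h; rw [h] at hτ'; simp at hτ'
  have h1 := logEta_add_int (im_neg_inv_pos hτ') A
  have h2 := logEta_neg_inv hτ'
  have h3 := logEta_add_int hτ D
  have hB : (B : ℂ) = A * D - 1 := by
    have : B = A * D - 1 := by linarith
    rw [this]; push_cast; ring
  have h4 : (A * τ + B) / ((1 : ℤ) * τ + D) = -1 / (τ + D) + A := by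
    rw [hB]
    push_cast
    rw [one_mul]
    field_simp
    ring
  rw [h4, h1, h2, h3, dedekindSum_one]
  push_cast
  rw [one_mul]
  ring

theorem DedekindFormula.of_inversion {A B C D : ℤ} (hdet : A * D - B * C = 1) (hC : 0 < C)
    (hD : 0 < D) (h : DedekindFormula B (-A) D (-C)) : DedekindFormula A B C D := by
  intro τ hτ
  have hτ' := im_neg_inv_pos hτ
  have hτ0 : τ ≠ 0 := by rintro rfl; simp at hτ
  have hC0 : (C : ℂ) ≠ 0 := by exact_mod_cast hC.ne'
  have hD0 : (D : ℂ) ≠ 0 := by exact_mod_cast hD.ne'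
  have hcop := isCoprime_of_det hdet
  have hden := denom_ne_zero hcop hτ
  have h1 := h (-1 / τ) hτ'
  rw [logEta_neg_inv hτ, dedekindSum_neg] at h1
  have e1 : ((B : ℂ) * (-1 / τ) + (-A : ℤ)) / (D * (-1 / τ) + (-C : ℤ)) =
      (A * τ + B) / (C * τ + D) := by
    have : (D : ℂ) * (-1 / τ) + (-C : ℤ) = -(C * τ + D) / τ := by
      push_cast; field_simp; ring
    rw [this]
    push_cast
    field_simp
    ring
  have e2 := log_neg_mul_of_im_pos hτ (im_denom_pos (D := -C) hD hτ')
  have e3 : -(τ * (D * (-1 / τ) + (-C : ℤ))) = C * τ + D := by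
    push_cast; field_simp; ring
  rw [e3] at e2
  have hrec : dedekindSum C D + dedekindSum D C =
      -1 / 4 + ((C : ℚ) ^ 2 + (D : ℚ) ^ 2 + 1) / (12 * C * D) := by
    have hcast1 : ((C.toNat : ℕ) : ℤ) = C := Int.toNat_of_nonneg hC.le
    have hcast2 : ((D.toNat : ℕ) : ℤ) = D := Int.toNat_of_nonneg hD.le
    have := dedekindSum_reciprocity (h := C.toNat) (k := D.toNat) (by lia) (by lia) (by
      rw [← Nat.isCoprime_iff_coprime, hcast1, hcast2]
      exact hcop)
    have q1 : ((C.toNat : ℕ) : ℚ) = C := by exact_mod_cast congrArg (Int.cast : ℤ → ℚ) hcast1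
    have q2 : ((D.toNat : ℕ) : ℚ) = D := by exact_mod_cast congrArg (Int.cast : ℤ → ℚ) hcast2
    rwa [hcast1, hcast2, q1, q2] at this
  have hrec' : (dedekindSum C D : ℂ) =
      -1 / 4 + ((C : ℂ) ^ 2 + (D : ℂ) ^ 2 + 1) / (12 * C * D) - dedekindSum D C := by
    have := congrArg (Rat.cast : ℚ → ℂ) hrec
    push_cast at this
    linear_combination this
  have hdet' : (A : ℂ) * D - B * C = 1 := by exact_mod_cast hdet
  rw [← e1, h1, e2]
  push_cast
  rw [hrec']
  have e4 : ((A : ℂ) + D) / (24 * C) = ((B : ℂ) - C) / (24 * D)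
      + ((C : ℂ) ^ 2 + (D : ℂ) ^ 2 + 1) / (24 * C * D) := by
    field_simp
    linear_combination hdet'
  rw [e4]
  field_simp
  ring

theorem dedekindFormula {A B C D : ℤ} (hdet : A * D - B * C = 1) (hC : 0 < C) :
    DedekindFormula A B C D := by
  obtain ⟨n, hn⟩ : ∃ n : ℕ, C ≤ n := ⟨C.toNat, by lia⟩
  induction n generalizing A B C D with
  | zero => lia
  | succ n ih =>
    rcases eq_or_lt_of_le (show 1 ≤ C from hC) with rfl | hC1
    · exact dedekindFormula_one hdet
    · apply DedekindFormula.of_translate hC (-(D / C))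
      have hmod : D + -(D / C) * C = D % C := by
        have := Int.emod_add_mul_ediv D C
        linear_combination -this
      have hdet' : A * (D % C) - (B + -(D / C) * A) * C = 1 := by
        rw [← hmod]; linear_combination hdet
      rw [hmod]
      have hpos : 0 < D % C := by
        refine lt_of_le_of_ne (Int.emod_nonneg _ hC.ne') fun h0 => ?_
        rw [← h0] at hdet'
        have : C ∣ 1 := ⟨-(B + -(D / C) * A), by linear_combination -hdet'⟩
        have := Int.le_of_dvd one_pos this
        lia
      have hlt : D % C < C := Int.emod_lt_of_pos _ hC
      exact DedekindFormula.of_inversion hdet' hC hpos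
        (ih (by linear_combination hdet') hpos (by lia))

end RatEis

namespace RatEis

open Complex Filter Topology UpperHalfPlane Matrix
open scoped MatrixGroups ModularForm Manifold
open Function.Periodic (qParam cuspFunction invQParam)

/-- A horizontally periodic function has a limit at `i∞` once it has one in a vertical strip. -/
theorem tendsto_atImInfty_of_periodic {φ : ℍ → ℂ} {h : ℝ} (hh : 0 < h)
    (hper : ∀ τ, φ (h +ᵥ τ) = φ τ) {l : Filter ℂ}
    (hφ : Tendsto φ (atImInfty ⊓ 𝓟 {τ | |τ.re| ≤ h}) l) : Tendsto φ atImInfty l := by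
  intro s hs
  obtain ⟨Y, hY⟩ := (atImInfty_mem _).mp (mem_inf_principal.mp (hφ hs))
  refine (atImInfty_mem _).mpr ⟨Y, fun τ hτ => ?_⟩
  have hint : ∀ (m : ℤ) (z : ℍ), φ (((m : ℝ) * h) +ᵥ z) = φ z := by
    intro m
    induction m using Int.induction_on with
    | zero => intro z; simp
    | succ n ih =>
      intro z
      rw [← ih z, ← hper ((((n : ℤ) : ℝ) * h) +ᵥ z), vadd_vadd]
      congr 2
      push_cast
      ring
    | pred n ih =>
      intro z
      rw [← ih z, ← hper (_ +ᵥ z), vadd_vadd]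
      congr 2
      push_cast
      ring
  have h1 := hint (-⌊τ.re / h⌋) τ
  rw [Set.mem_preimage, ← h1]
  refine hY _ (by simpa using hτ) ?_
  rw [Set.mem_ofPred_eq, vadd_re]
  have h2 := Int.floor_le (τ.re / h)
  have h3 := Int.lt_floor_add_one (τ.re / h)
  rw [le_div_iff₀ hh] at h2
  rw [div_lt_iff₀ hh] at h3
  push_cast
  rw [abs_le]
  constructor <;> linarith

theorem periodic_comp_ofComplex {F : ℍ → ℂ} (hper : ∀ τ, F ((1 : ℝ) +ᵥ τ) = F τ) :
    Function.Periodic (F ∘ ofComplex) ((1 : ℝ) : ℂ) := by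
  intro w
  by_cases hw : 0 < w.im
  · have him : 0 < (w + (1 : ℝ)).im := by simpa using hw
    simp only [Function.comp_apply, ofComplex_apply_of_im_pos hw, ofComplex_apply_of_im_pos him]
    rw [← hper ⟨w, hw⟩]
    congr 1
    ext
    simp [add_comm]
  · have him : (w + (1 : ℝ)).im ≤ 0 := by simpa using hw
    simp only [Function.comp_apply, ofComplex_apply_of_im_nonpos (not_lt.mp hw),
      ofComplex_apply_of_im_nonpos him]

/-- A `1`-periodic holomorphic function on the upper half plane that is `o(1 / q)` at `i∞` is
bounded there. -/
theorem isBoundedAtImInfty_of_qParam_mul_tendsto_zero {F : ℍ → ℂ} (hF : MDiff F)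
    (hper : ∀ τ, F ((1 : ℝ) +ᵥ τ) = F τ)
    (hq : Tendsto (fun τ : ℍ => qParam 1 τ * F τ) atImInfty (𝓝 0)) : IsBoundedAtImInfty F := by
  have hP := periodic_comp_ofComplex hper
  rw [UpperHalfPlane.mdifferentiable_iff] at hF
  have hd : ∀ᶠ q in 𝓝[≠] 0, DifferentiableAt ℂ (cuspFunction 1 (F ∘ ofComplex)) q := by
    refine Function.Periodic.eventually_differentiableAt_cuspFunction_nhds_ne_zero one_pos hP ?_
    filter_upwards [preimage_mem_comap (Ioi_mem_atTop (0 : ℝ))] with z hz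
    exact hF.differentiableAt (isOpen_upperHalfPlaneSet.mem_nhds hz)
  have h1 : Tendsto (fun q => q * cuspFunction 1 (F ∘ ofComplex) q) (𝓝[≠] 0) (𝓝 0) := by
    refine ((hq.comp tendsto_comap_im_ofComplex).comp
      (Function.Periodic.invQParam_tendsto one_pos)).congr' ?_
    have hev := (Function.Periodic.invQParam_tendsto (h := 1) one_pos).eventually
      (preimage_mem_comap (Ioi_mem_atTop (0 : ℝ)))
    filter_upwards [self_mem_nhdsWithin, hev] with q hq0 hq1
    rw [Function.Periodic.cuspFunction_eq_of_nonzero _ _ hq0]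
    simp only [Function.comp_apply]
    congr 1
    rw [ofComplex_apply_of_im_pos hq1]
    exact Function.Periodic.qParam_right_inv one_ne_zero hq0
  have h2 : (fun q => cuspFunction 1 (F ∘ ofComplex) q - cuspFunction 1 (F ∘ ofComplex) 0)
      =o[𝓝[≠] 0] fun q : ℂ => (q - 0)⁻¹ := by
    rw [Asymptotics.isLittleO_iff_tendsto' ?_]
    · have h3 : Tendsto (fun q : ℂ => q * cuspFunction 1 (F ∘ ofComplex) 0) (𝓝[≠] 0) (𝓝 0) := by
        have : Tendsto (fun q : ℂ => q * cuspFunction 1 (F ∘ ofComplex) 0) (𝓝 0) (𝓝 (0 * _)) :=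
          tendsto_id.mul_const _
        rw [zero_mul] at this
        exact this.mono_left nhdsWithin_le_nhds
      have h4 := h1.sub h3
      rw [sub_zero] at h4
      refine h4.congr fun q => ?_
      rw [sub_zero, div_inv_eq_mul]
      ring
    · filter_upwards [self_mem_nhdsWithin] with q hq0 h
      exact absurd (by simpa using h) hq0
  have h5 := tendsto_limUnder_of_differentiable_on_punctured_nhds_of_isLittleO hd h2
  have h6 := (h5.comp (Function.Periodic.qParam_tendsto one_pos)).comp tendsto_coe_atImInfty
  have h7 : Tendsto F atImInfty
      (𝓝 (limUnder (𝓝[≠] 0) (cuspFunction 1 (F ∘ ofComplex)))) := by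
    refine h6.congr fun τ => ?_
    simp only [Function.comp_apply]
    rw [Function.Periodic.eq_cuspFunction one_ne_zero hP]
    simp
  exact h7.isBigO_one ℝ

/-- A holomorphic function on the upper half plane that is invariant under `Γ₀(p)`, `p` prime,
bounded at the cusp `∞`, and has a limit at the cusp `0`, is constant. -/
theorem eq_of_Gamma0_invariant {p : ℕ} [Fact p.Prime] {F : ℍ → ℂ} (hF : MDiff F)
    (hinv : ∀ σ ∈ CongruenceSubgroup.Gamma0 p, ∀ τ, F (σ • τ) = F τ)
    (hinf : IsBoundedAtImInfty F) {c : ℂ}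
    (hzero : Tendsto (fun τ => F (ModularGroup.S • τ)) atImInfty (𝓝 c)) (τ : ℍ) : F τ = c := by
  have : NeZero p := ⟨(Fact.out : p.Prime).ne_zero⟩
  have hbdd : ∀ γ : SL(2, ℤ), IsBoundedAtImInfty (F ∣[(0 : ℤ)] γ) := by
    intro γ
    have e : F ∣[(0 : ℤ)] γ = fun τ => F (γ • τ) := by
      ext τ
      simp [ModularForm.SL_slash_apply]
    rw [e]
    by_cases hγ : γ ∈ CongruenceSubgroup.Gamma0 p
    · simpa only [hinv γ hγ] using hinf
    · rw [CongruenceSubgroup.Gamma0_mem] at hγ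
      obtain ⟨j, hj⟩ := ZMod.intCast_surjective ((γ 1 1 : ZMod p) / (γ 1 0 : ZMod p))
      have hσ : γ * ModularGroup.T ^ (-j) * ModularGroup.S⁻¹ ∈ CongruenceSubgroup.Gamma0 p := by
        rw [CongruenceSubgroup.Gamma0_mem]
        have : (γ * ModularGroup.T ^ (-j) * ModularGroup.S⁻¹) 1 0 = γ 1 0 * j - γ 1 1 := by
          have hS : (ModularGroup.S⁻¹ : SL(2, ℤ)).1 = !![0, 1; -1, 0] := by
            rw [Matrix.SpecialLinearGroup.coe_inv, ModularGroup.S, Matrix.adjugate_fin_two]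
            simp
          rw [Matrix.SpecialLinearGroup.coe_mul, Matrix.SpecialLinearGroup.coe_mul, hS,
            ModularGroup.coe_T_zpow]
          simp [Matrix.mul_apply, Fin.sum_univ_two]
          ring
        rw [this]
        push_cast
        rw [hj]
        field_simp
        ring
      have h1 : ∀ τ, F (γ • τ) = F (ModularGroup.S • ModularGroup.T ^ j • τ) := by
        intro τ
        rw [← hinv _ hσ (ModularGroup.S • _), smul_smul, smul_smul]
        congr 2
        group
      simp only [h1]
      have h2 : Tendsto (fun τ : ℍ => ModularGroup.T ^ j • τ) atImInfty atImInfty := by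
        simp only [modular_T_zpow_smul]
        rw [atImInfty, tendsto_comap_iff]
        refine tendsto_comap.congr fun τ => ?_
        simp
      exact (hzero.comp h2).isBigO_one ℝ
  let f : ModularForm (CongruenceSubgroup.Gamma0 p : Subgroup (GL (Fin 2) ℝ)) 0 :=
    { toFun := F
      slash_action_eq' := by
        rintro _ ⟨σ, hσ, rfl⟩
        ext τ
        have := ModularForm.SL_slash_apply (k := 0) F σ τ
        rw [hinv σ hσ] at this
        simpa using! this
      holo' := hF
      bdd_at_cusps' := by
        intro c hc
        rw [Subgroup.IsArithmetic.isCusp_iff_isCusp_SL2Z] at hc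
        rw [OnePoint.isBoundedAt_iff_forall_SL2Z hc]
        exact fun γ _ => hbdd γ }
  obtain ⟨a, ha⟩ := ModularForm.eq_const_of_weight_zero f
  have hconst : ∀ τ, F τ = a := fun τ => congrFun ha τ
  simp only [hconst] at hzero ⊢
  exact tendsto_nhds_unique tendsto_const_nhds hzero

end RatEis

namespace RatEis

open Complex Filter Topology
open UpperHalfPlane (upperHalfPlaneSet)

/-- The eta quotient `η^{r₁}(τ) η^{rₚ}(pτ)`. -/
def etaQuotient (p : ℕ) (r₁ rₚ : ℚ) (τ : ℂ) : ℂ := etaPow r₁ τ * etaPow rₚ (p * τ)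

/-- The reciprocal `η^{-r₁}(u) η^{-rₚ}(u/p)` of the eta quotient at the cusp `0`. -/
def cuspQuotient (p : ℕ) (r₁ rₚ : ℚ) (u : ℂ) : ℂ := etaPow (-r₁) u * etaPow (-rₚ) (u / p)

/-- The constant `p^{rₚ/2} e((r₁ + rₚ)/8 - (r₁ + p rₚ)/24)`. -/
def eisConst (p : ℕ) (r₁ rₚ : ℚ) : ℂ :=
  exp (rₚ / 2 * Real.log p + Real.pi * I * (r₁ + rₚ) / 4 - Real.pi * I * (r₁ + p * rₚ) / 12)

theorem etaQuotient_eq_exp (p : ℕ) (r₁ rₚ : ℚ) (τ : ℂ) :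
    etaQuotient p r₁ rₚ τ = exp (r₁ * logEta τ + rₚ * logEta (p * τ)) := by
  rw [etaQuotient, etaPow, etaPow, ← exp_add]

theorem cuspQuotient_eq_exp (p : ℕ) (r₁ rₚ : ℚ) (u : ℂ) :
    cuspQuotient p r₁ rₚ u = exp (-r₁ * logEta u - rₚ * logEta (u / p)) := by
  rw [cuspQuotient, etaPow, etaPow, ← exp_add]
  push_cast
  ring_nf

theorem etaQuotient_ne_zero (p : ℕ) (r₁ rₚ : ℚ) (τ : ℂ) : etaQuotient p r₁ rₚ τ ≠ 0 := by
  rw [etaQuotient_eq_exp]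
  exact exp_ne_zero _

theorem eisConst_ne_zero (p : ℕ) (r₁ rₚ : ℚ) : eisConst p r₁ rₚ ≠ 0 := exp_ne_zero _

theorem im_natCast_mul_pos {p : ℕ} (hp : 0 < p) {τ : ℂ} (hτ : 0 < τ.im) :
    0 < ((p : ℂ) * τ).im := by
  have : (0 : ℝ) < p := by exact_mod_cast hp
  simpa using mul_pos this hτ

theorem im_div_natCast_pos {p : ℕ} (hp : 0 < p) {τ : ℂ} (hτ : 0 < τ.im) :
    0 < (τ / (p : ℂ)).im := by
  have : (0 : ℝ) < p := by exact_mod_cast hp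
  rw [div_natCast_im]
  positivity

theorem differentiableOn_etaQuotient {p : ℕ} (hp : 0 < p) (r₁ rₚ : ℚ) :
    DifferentiableOn ℂ (etaQuotient p r₁ rₚ) upperHalfPlaneSet := by
  have h1 : DifferentiableOn ℂ (fun τ : ℂ => logEta (p * τ)) upperHalfPlaneSet :=
    differentiableOn_logEta.comp (by fun_prop) fun τ hτ => im_natCast_mul_pos hp hτ
  have h2 := differentiableOn_logEta
  exact (((h2.const_mul (r₁ : ℂ)).add (h1.const_mul (rₚ : ℂ))).cexp).congr
    fun τ _ => etaQuotient_eq_exp p r₁ rₚ τ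

theorem cuspQuotient_add_int_mul {p : ℕ} (hp : 0 < p) {r₁ rₚ : ℚ} (hr : p * r₁ + rₚ = 0)
    {u : ℂ} (hu : 0 < u.im) (m : ℤ) :
    cuspQuotient p r₁ rₚ (u + p * m) = cuspQuotient p r₁ rₚ u := by
  have hp0 : (p : ℂ) ≠ 0 := by exact_mod_cast hp.ne'
  have h1 := logEta_add_int hu (p * m)
  have h2 := logEta_add_int (im_div_natCast_pos hp hu) m
  have h3 : (u + p * m) / p = u / p + m := by field_simp
  have hr' : (p : ℂ) * r₁ + rₚ = 0 := by exact_mod_cast congrArg (Rat.cast : ℚ → ℂ) hr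
  push_cast at h1
  rw [cuspQuotient_eq_exp, cuspQuotient_eq_exp, h3, h1, h2]
  congr 1
  linear_combination (-(Real.pi * I * m / 12) : ℂ) * hr'

theorem log_div_natCast {p : ℕ} (hp : 0 < p) {u : ℂ} (hu : 0 < u.im) :
    log (u / p) = log u - Real.log p := by
  have hu0 : u ≠ 0 := by rintro rfl; simp at hu
  have hp' : (0 : ℝ) < p := by exact_mod_cast hp
  have : u / p = ((p : ℝ)⁻¹ : ℝ) * u := by push_cast; rw [div_eq_inv_mul]
  rw [this, log_ofReal_mul (inv_pos.mpr hp') hu0, Real.log_inv]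
  push_cast
  ring

/-- The terms of the Eisenstein series as translates of a fixed function. -/
theorem eisTerm_identity {p : ℕ} (hp : 0 < p) (r₁ rₚ : ℚ) {a b c d : ℤ}
    (hdet : a * d - b * c = 1) (hc : 0 < c) (hdvd : (p : ℤ) ∣ a + c) (hac : 0 < a + c)
    {τ : ℂ} (hτ : 0 < τ.im) :
    ((c : ℂ) * τ + d) ^ (-(((r₁ + rₚ) / 2 : ℚ) : ℂ)) * e (eisOnePhase p r₁ rₚ a b c d : ℚ) =
      eisConst p r₁ rₚ * (etaQuotient p r₁ rₚ τ *
        cuspQuotient p r₁ rₚ ((a * τ + b) / (c * τ + d) + 1)) := by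
  obtain ⟨C', hC'⟩ := hdvd
  have hpZ : (0 : ℤ) < p := by exact_mod_cast hp
  have hC'0 : 0 < C' := by
    rw [hC'] at hac
    exact pos_of_mul_pos_right hac hpZ.le
  have hpC : (p : ℂ) ≠ 0 := by exact_mod_cast hp.ne'
  have hpQ : (p : ℚ) ≠ 0 := by exact_mod_cast hp.ne'
  have hcd := denom_ne_zero (isCoprime_of_det hdet) hτ
  have hw := im_moebius_pos hdet hτ
  set w : ℂ := (a * τ + b) / (c * τ + d) with hwdef
  have hu : 0 < (w + 1).im := by simpa using hw
  have hu0 : w + 1 ≠ 0 := by intro h; rw [h] at hu; simp at hu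
  have hCτ := im_denom_pos (D := b + d) hac hτ
  have hmul : (((a + c : ℤ) : ℂ) * τ + (b + d : ℤ)) = (w + 1) * (c * τ + d) := by
    rw [hwdef]
    push_cast
    field_simp
    ring
  have hlog : log (((a + c : ℤ) : ℂ) * τ + (b + d : ℤ)) = log (w + 1) + log (c * τ + d) := by
    rw [hmul]
    exact log_mul_of_im_pos hu (im_denom_pos hc hτ) (hmul ▸ hCτ)
  have hδ : ((a : ℂ) * τ + b) / ((a + c : ℤ) * τ + (b + d : ℤ)) = -1 / (w + 1) + 1 := by
    have hwm : w * (c * τ + d) = a * τ + b := div_mul_cancel₀ _ hcd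
    rw [hmul, ← hwm]
    field_simp
    ring
  have hE1 := dedekindFormula (A := a) (B := b) (C := a + c) (D := b + d)
    (by linear_combination hdet) hac τ hτ
  have hCp : ((a + c : ℤ) : ℂ) = p * C' := by rw [hC']; push_cast; ring
  have hE2 := dedekindFormula (A := a) (B := p * b) (C := C') (D := b + d)
    (by linear_combination hdet + b * hC') hC'0 (p * τ) (im_natCast_mul_pos hp hτ)
  have hden2 : (C' : ℂ) * (p * τ) + (b + d : ℤ) = ((a + c : ℤ) : ℂ) * τ + (b + d : ℤ) := by
    rw [hCp]; ring
  have hnum2 : ((a : ℂ) * (p * τ) + (p * b : ℤ)) / (((a + c : ℤ) : ℂ) * τ + (b + d : ℤ)) =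
      -1 / ((w + 1) / p) + (p : ℤ) := by
    have : ((a : ℂ) * (p * τ) + (p * b : ℤ)) = p * (a * τ + b) := by push_cast; ring
    rw [this, mul_div_assoc, hδ]
    push_cast
    field_simp
  have hE3 := logEta_add_int (im_neg_inv_pos hu) 1
  have hE4 := logEta_add_int (im_neg_inv_pos (im_div_natCast_pos hp hu)) p
  rw [logEta_neg_inv hu] at hE3
  rw [logEta_neg_inv (im_div_natCast_pos hp hu), log_div_natCast hp hu] at hE4
  rw [hδ, hlog] at hE1
  rw [hden2, hnum2, hlog] at hE2
  rw [Int.cast_one, mul_one] at hE3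
  rw [hE3] at hE1
  rw [hE4] at hE2
  have hdivp : (a + c) / (p : ℤ) = C' := by
    rw [hC']; exact Int.mul_ediv_cancel_left _ hpZ.ne'
  have hdivq : ((a : ℚ) + c) / p = C' := by
    rw [div_eq_iff hpQ]
    have : ((a + c : ℤ) : ℚ) = ((p * C' : ℤ) : ℚ) := by rw [hC']
    push_cast at this
    linear_combination this
  have hphase : eisOnePhase p r₁ rₚ a b c d =
      -r₁ * (((a : ℚ) + (b + d : ℤ)) / (24 * (a + c : ℤ)) - dedekindSum (b + d) (a + c) / 2 - 1 / 8)
      - rₚ * (((a : ℚ) + (b + d : ℤ)) / (24 * C') - dedekindSum (b + d) C' / 2 - 1 / 8) := by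
    rw [eisOnePhase, hdivp, hdivq, show -b - d = -(b + d) by ring, dedekindSum_neg,
      dedekindSum_neg]
    push_cast
    ring
  rw [cpow_def_of_ne_zero hcd, e, etaQuotient_eq_exp, cuspQuotient_eq_exp, eisConst,
    ← exp_add, ← exp_add, ← exp_add, hphase]
  congr 1
  generalize ((a : ℚ) + (b + d : ℤ)) / (24 * (a + c : ℤ)) - dedekindSum (b + d) (a + c) / 2 = X₁
    at *
  generalize ((a : ℚ) + (b + d : ℤ)) / (24 * C') - dedekindSum (b + d) C' / 2 = X₂ at *
  push_cast at hE1 hE2 ⊢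
  linear_combination (r₁ : ℂ) * hE1 + (rₚ : ℂ) * hE2

end RatEis

namespace RatEis

open Complex Filter Topology
open UpperHalfPlane hiding I
open scoped MatrixGroups ModularForm Manifold
open Function.Periodic (qParam)

theorem norm_e_ratCast (x : ℚ) : ‖e (x : ℂ)‖ = 1 := by
  rw [e, show (2 * Real.pi * I * (x : ℂ)) = ((2 * Real.pi * x : ℝ) : ℂ) * I by push_cast; ring,
    norm_exp_ofReal_mul_I]

theorem norm_eisOneTerm {p : ℕ} (k r₁ rₚ : ℚ) (L : CuspLift p) (τ : ℂ) (x : CuspPair p) :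
    ‖eisOneTerm p k r₁ rₚ L τ x‖ = ‖(x.1.1 : ℂ) * τ + x.1.2‖ ^ (-(k : ℝ)) := by
  rw [eisOneTerm, norm_mul, norm_e_ratCast, mul_one,
    show (-(k : ℂ)) = ((-(k : ℝ) : ℝ) : ℂ) by push_cast; rfl, norm_cpow_real]

theorem summable_cuspPair (p : ℕ) {k : ℝ} (hk : 2 < k) :
    Summable fun x : CuspPair p => ‖![x.1.1, x.1.2]‖ ^ (-k) := by
  have hinj : Function.Injective fun x : CuspPair p => ![x.1.1, x.1.2] := by
    intro x y hxy
    have h0 := congrFun hxy 0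
    have h1 := congrFun hxy 1
    exact Subtype.ext (Prod.ext (by simpa using h0) (by simpa using h1))
  exact (EisensteinSeries.summable_one_div_norm_rpow hk).comp_injective hinj

theorem norm_linear_rpow_le {k : ℝ} (hk : 0 ≤ k) (c d : ℤ) {A B : ℝ} (hB : 0 < B) {τ : ℍ}
    (hτ : τ ∈ verticalStrip A B) :
    ‖(c : ℂ) * τ + d‖ ^ (-k) ≤ EisensteinSeries.r ⟨⟨A, B⟩, hB⟩ ^ (-k) * ‖![c, d]‖ ^ (-k) := by
  simpa using EisensteinSeries.summand_bound_of_mem_verticalStrip hk ![c, d] hB hτ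

theorem summable_eisOneTerm {p : ℕ} {k : ℚ} (hk : 2 < k) (r₁ rₚ : ℚ) (L : CuspLift p) (τ : ℍ) :
    Summable (eisOneTerm p k r₁ rₚ L τ) := by
  have hk' : (2 : ℝ) < k := by exact_mod_cast hk
  refine Summable.of_norm_bounded ((summable_cuspPair p hk').mul_left
    (EisensteinSeries.r ⟨⟨|τ.re|, τ.im⟩, τ.2⟩ ^ (-(k : ℝ)))) fun x => ?_
  rw [norm_eisOneTerm]
  exact norm_linear_rpow_le (by linarith) _ _ _ (by simp [mem_verticalStrip_iff])

theorem differentiableOn_eisOne {p : ℕ} {k : ℚ} (hk : 2 < k) (r₁ rₚ : ℚ) (L : CuspLift p) :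
    DifferentiableOn ℂ (eisOne p k r₁ rₚ L) upperHalfPlaneSet := by
  intro z hz
  have hz : 0 < z.im := hz
  have hk' : (2 : ℝ) < k := by exact_mod_cast hk
  let V : Set ℂ := {w | |w.re| < |z.re| + 1} ∩ {w | z.im / 2 < w.im}
  have hV : IsOpen V := (isOpen_lt (by fun_prop) (by fun_prop)).inter
    (isOpen_lt (by fun_prop) (by fun_prop))
  have hzV : z ∈ V := ⟨by simp, by simpa using half_lt_self hz⟩
  have hpos : ∀ w ∈ V, 0 < w.im := fun w hw => (half_pos hz).trans hw.2
  refine (DifferentiableOn.differentiableAt (s := V) ?_ (hV.mem_nhds hzV)).differentiableWithinAt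
  refine differentiableOn_tsum_of_summable_norm ((summable_cuspPair p hk').mul_left
    (EisensteinSeries.r ⟨⟨|z.re| + 1, z.im / 2⟩, half_pos hz⟩ ^ (-(k : ℝ)))) ?_ hV ?_
  · intro x w hw
    refine DifferentiableAt.differentiableWithinAt ?_
    refine DifferentiableAt.mul_const (DifferentiableAt.cpow_const (by fun_prop) ?_) _
    exact Or.inr (im_denom_pos x.2.1 (hpos w hw)).ne'
  · intro x w hw
    rw [norm_eisOneTerm]
    refine norm_linear_rpow_le (τ := ⟨w, hpos w hw⟩) (by linarith) _ _ _ ?_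
    rw [mem_verticalStrip_iff]
    exact ⟨hw.1.le, hw.2.le⟩

theorem tendsto_norm_linear_rpow {k : ℝ} (hk : 0 < k) {c : ℤ} (hc : c ≠ 0) (d : ℤ) :
    Tendsto (fun τ : ℍ => ‖(c : ℂ) * τ + d‖ ^ (-k)) atImInfty (𝓝 0) := by
  refine (tendsto_rpow_neg_atTop hk).comp ?_
  have h1 : Tendsto (fun τ : ℍ => |(c : ℝ)| * τ.im) atImInfty atTop :=
    tendsto_comap.const_mul_atTop (abs_pos.mpr (by exact_mod_cast hc))
  refine tendsto_atTop_mono (fun τ => ?_) h1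
  have h2 := abs_im_le_norm ((c : ℂ) * τ + d)
  have h3 : ((c : ℂ) * τ + d).im = c * τ.im := by simp
  rwa [h3, abs_mul, abs_of_pos τ.im_pos] at h2

theorem eventually_mem_verticalStrip (A : ℝ) :
    ∀ᶠ τ : ℍ in atImInfty ⊓ 𝓟 {τ | |τ.re| ≤ A}, τ ∈ verticalStrip A 1 := by
  have h1 : ∀ᶠ τ : ℍ in atImInfty, 1 ≤ τ.im := (atImInfty_mem _).mpr ⟨1, fun _ h => h⟩
  filter_upwards [mem_inf_of_left h1, mem_inf_of_right (mem_principal_self _)] with τ h2 h3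
  exact (mem_verticalStrip_iff _ _ _).mpr ⟨h3, h2⟩

theorem tendsto_eisOne {p : ℕ} {k : ℚ} (hk : 2 < k) (r₁ rₚ : ℚ) (L : CuspLift p) (A : ℝ) :
    Tendsto (fun τ : ℍ => eisOne p k r₁ rₚ L τ) (atImInfty ⊓ 𝓟 {τ | |τ.re| ≤ A}) (𝓝 0) := by
  have hk' : (2 : ℝ) < k := by exact_mod_cast hk
  rw [← tsum_zero (α := ℂ) (β := CuspPair p)]
  refine tendsto_tsum_of_dominated_convergence ((summable_cuspPair p hk').mul_left
    (EisensteinSeries.r ⟨⟨A, 1⟩, one_pos⟩ ^ (-(k : ℝ)))) ?_ ?_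
  · intro x
    rw [tendsto_zero_iff_norm_tendsto_zero]
    simp only [norm_eisOneTerm]
    exact (tendsto_norm_linear_rpow (by linarith) x.2.1.ne' _).mono_left inf_le_left
  · filter_upwards [eventually_mem_verticalStrip A] with τ hτ x
    rw [norm_eisOneTerm]
    exact norm_linear_rpow_le (by linarith) _ _ _ hτ

theorem tendsto_logEta_sub_natCast_mul {p : ℕ} (hp : 0 < p) :
    Tendsto (fun τ : ℍ => logEta (p * τ) - Real.pi * I * (p * τ) / 12) atImInfty (𝓝 0) := by
  have h1 : Tendsto (fun τ : ℍ => (p : ℂ) * τ) atImInfty (comap Complex.im atTop) := by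
    rw [tendsto_comap_iff]
    have : Tendsto (fun τ : ℍ => (p : ℝ) * τ.im) atImInfty atTop :=
      tendsto_comap.const_mul_atTop (by exact_mod_cast hp)
    exact this.congr fun τ => by simp
  exact tendsto_logEta_sub.comp h1

theorem tendsto_logEta_sub_div_natCast {p : ℕ} (hp : 0 < p) :
    Tendsto (fun τ : ℍ => logEta (τ / p) - Real.pi * I * (τ / p) / 12) atImInfty (𝓝 0) := by
  have h1 : Tendsto (fun τ : ℍ => (τ : ℂ) / p) atImInfty (comap Complex.im atTop) := by
    rw [tendsto_comap_iff]
    have : Tendsto (fun τ : ℍ => τ.im / (p : ℝ)) atImInfty atTop :=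
      tendsto_comap.atTop_div_const (by exact_mod_cast hp)
    exact this.congr fun τ => by simp [div_natCast_im]
  exact tendsto_logEta_sub.comp h1

theorem tendsto_logEta_sub_coe :
    Tendsto (fun τ : ℍ => logEta τ - Real.pi * I * τ / 12) atImInfty (𝓝 0) :=
  tendsto_logEta_sub.comp tendsto_coe_atImInfty

theorem tendsto_cuspQuotient {p : ℕ} (hp : 0 < p) {r₁ rₚ : ℚ} (hr : p * r₁ + rₚ = 0) :
    Tendsto (fun τ : ℍ => cuspQuotient p r₁ rₚ τ) atImInfty (𝓝 1) := by
  have hp0 : (p : ℂ) ≠ 0 := by exact_mod_cast hp.ne'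
  have hr' : (p : ℂ) * r₁ + rₚ = 0 := by exact_mod_cast congrArg (Rat.cast : ℚ → ℂ) hr
  have h := ((tendsto_logEta_sub_coe.const_mul (-(r₁ : ℂ))).sub
    ((tendsto_logEta_sub_div_natCast hp).const_mul (rₚ : ℂ))).cexp
  simp only [mul_zero, sub_zero, exp_zero] at h
  refine h.congr fun τ => ?_
  rw [cuspQuotient_eq_exp]
  congr 1
  have : (rₚ : ℂ) = -p * r₁ := by linear_combination hr'
  rw [this]
  field_simp
  ring

/-- The quotient of `q` by an eta quotient of order at most one at `i∞` is bounded there. -/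
theorem isBoundedAtImInfty_qParam_div_etaQuotient {p : ℕ} (hp : 0 < p) {r₁ rₚ : ℚ}
    (hn : (r₁ + p * rₚ) / 24 ≤ 1) :
    IsBoundedAtImInfty fun τ : ℍ => qParam 1 τ / etaQuotient p r₁ rₚ τ := by
  have h := ((tendsto_logEta_sub_coe.const_mul (-(r₁ : ℂ))).sub
    ((tendsto_logEta_sub_natCast_mul hp).const_mul (rₚ : ℂ))).cexp
  refine (Asymptotics.IsBigO.of_bound 1 (Eventually.of_forall fun τ => ?_)).trans (h.isBigO_one ℝ)
  have e1 : qParam 1 τ / etaQuotient p r₁ rₚ τ =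
      exp (2 * Real.pi * I * ((1 - (r₁ + p * rₚ) / 24 : ℚ) : ℂ) * τ) *
      exp (-(r₁ : ℂ) * (logEta τ - Real.pi * I * τ / 12) -
        (rₚ : ℂ) * (logEta (p * τ) - Real.pi * I * (p * τ) / 12)) := by
    rw [etaQuotient_eq_exp, qParam, ← exp_sub, ← exp_add]
    congr 1
    push_cast
    ring
  rw [e1, norm_mul]
  refine mul_le_mul_of_nonneg_right ?_ (norm_nonneg _)
  rw [norm_exp, Real.exp_le_one_iff]
  have hn' : (0 : ℝ) ≤ (1 - (r₁ + p * rₚ) / 24 : ℚ) := by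
    exact_mod_cast sub_nonneg.mpr hn
  have e2 : (2 * Real.pi * I * ((1 - (r₁ + p * rₚ) / 24 : ℚ) : ℂ) * τ) =
      ((2 * Real.pi * (1 - (r₁ + p * rₚ) / 24 : ℚ) : ℝ) : ℂ) * (I * τ) := by
    push_cast; ring
  rw [e2, re_ofReal_mul]
  have := τ.im_pos
  have h3 : (I * (τ : ℂ)).re = -τ.im := by simp
  rw [h3]
  have : 0 ≤ 2 * Real.pi * ((1 - (r₁ + p * rₚ) / 24 : ℚ) : ℝ) := by positivity
  nlinarith

/-- The behaviour of the eta quotient under `τ ↦ -1/τ`. -/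
theorem norm_etaQuotient_neg_inv {p : ℕ} (hp : 0 < p) (r₁ rₚ : ℚ) {τ : ℂ} (hτ : 0 < τ.im) :
    ‖eisConst p r₁ rₚ‖ * ‖etaQuotient p r₁ rₚ (-1 / τ)‖ * ‖cuspQuotient p r₁ rₚ τ‖ =
      ‖τ‖ ^ (((r₁ + rₚ) / 2 : ℚ) : ℝ) := by
  have hp0 : (p : ℂ) ≠ 0 := by exact_mod_cast hp.ne'
  have hτ0 : τ ≠ 0 := by rintro rfl; simp at hτ
  have h1 := logEta_neg_inv hτ
  have h2 := logEta_neg_inv (im_div_natCast_pos hp hτ)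
  rw [log_div_natCast hp hτ, show -1 / (τ / (p : ℂ)) = p * (-1 / τ) by field_simp] at h2
  rw [← norm_mul, ← norm_mul, ← norm_cpow_real, cpow_def_of_ne_zero hτ0, etaQuotient_eq_exp,
    cuspQuotient_eq_exp, eisConst, ← exp_add, ← exp_add, norm_exp, norm_exp, h1, h2]
  congr 1
  have e1 : ∀ y : ℚ, (Real.pi * I * (y : ℂ)).re = 0 := by
    intro y
    rw [show (Real.pi * I * (y : ℂ)) = ((Real.pi * y : ℝ) : ℂ) * I by push_cast; ring]
    simp
  have e2 := e1 (-(r₁ + p * rₚ) / 12)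
  rw [← sub_eq_zero, ← sub_re]
  rw [← e2]
  congr 1
  push_cast
  ring

theorem coe_smul_eq (γ : SL(2, ℤ)) (τ : ℍ) :
    ((γ • τ : ℍ) : ℂ) = (γ 0 0 * τ + γ 0 1) / (γ 1 0 * τ + γ 1 1) := by
  rw [UpperHalfPlane.coe_specialLinearGroup_apply]
  simp

theorem det_eq_one (γ : SL(2, ℤ)) : γ 0 0 * γ 1 1 - γ 0 1 * γ 1 0 = 1 := by
  rw [← Matrix.det_fin_two, γ.det_coe]

theorem mul_apply_eq (γ σ : SL(2, ℤ)) (i j : Fin 2) :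
    (γ * σ) i j = γ i 0 * σ 0 j + γ i 1 * σ 1 j := by
  rw [Matrix.SpecialLinearGroup.coe_mul, Matrix.mul_apply, Fin.sum_univ_two]

/-- The matrix with bottom row `x` that belongs to a choice of lifts. -/
def CuspLift.toSL {p : ℕ} (L : CuspLift p) (x : CuspPair p) : SL(2, ℤ) :=
  ⟨!![L.a x, L.b x; x.1.1, x.1.2], by rw [Matrix.det_fin_two_of]; exact L.det_eq x⟩

theorem CuspLift.coe_toSL_smul {p : ℕ} (L : CuspLift p) (x : CuspPair p) (τ : ℍ) :
    ((L.toSL x • τ : ℍ) : ℂ) = (L.a x * τ + L.b x) / (x.1.1 * τ + x.1.2) := by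
  rw [coe_smul_eq]
  simp [CuspLift.toSL]

theorem exists_translate_of_bottom_row_eq {p : ℕ} {γ γ' : SL(2, ℤ)}
    (h0 : γ' 1 0 = γ 1 0) (h1 : γ' 1 1 = γ 1 1) (hc0 : γ 1 0 ≠ 0)
    (hc : IsCoprime (p : ℤ) (γ 1 0))
    (hγ : (p : ℤ) ∣ γ 0 0 + γ 1 0) (hγ' : (p : ℤ) ∣ γ' 0 0 + γ' 1 0) :
    ∃ m : ℤ, ∀ τ : ℍ, ((γ' • τ : ℍ) : ℂ) = (γ • τ : ℍ) + p * m := by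
  have hd := det_eq_one γ
  have hd' := det_eq_one γ'
  rw [h0] at hγ'
  rw [h0, h1] at hd'
  have hcop : IsCoprime (γ 1 0) (γ 1 1) := isCoprime_of_det hd
  have hdvd : γ 1 0 ∣ (γ' 0 0 - γ 0 0) * γ 1 1 :=
    ⟨γ' 0 1 - γ 0 1, by linear_combination hd' - hd⟩
  obtain ⟨j, hj⟩ := hcop.dvd_of_dvd_mul_right hdvd
  have hpj : (p : ℤ) ∣ γ 1 0 * j := by
    rw [← hj]
    have := dvd_sub hγ' hγ
    rwa [add_sub_add_right_eq_sub] at this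
  obtain ⟨m, rfl⟩ := hc.dvd_of_dvd_mul_left hpj
  refine ⟨m, fun τ => ?_⟩
  have hden := denom_ne_zero hcop τ.im_pos
  have hb : γ' 0 1 - γ 0 1 = γ 1 1 * (p * m) := by
    have e1 : γ 1 0 * (γ' 0 1 - γ 0 1 - γ 1 1 * (p * m)) = 0 := by
      linear_combination hd - hd' + γ 1 1 * hj
    linear_combination (mul_eq_zero.mp e1).resolve_left hc0
  rw [coe_smul_eq, coe_smul_eq, h0, h1]
  have hj' : (γ' 0 0 : ℂ) = γ 0 0 + γ 1 0 * (p * m) := by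
    have : γ' 0 0 = γ 0 0 + γ 1 0 * (p * m) := by linear_combination hj
    rw [this]; push_cast; ring
  have hb' : (γ' 0 1 : ℂ) = γ 0 1 + γ 1 1 * (p * m) := by
    have : γ' 0 1 = γ 0 1 + γ 1 1 * (p * m) := by linear_combination hb
    rw [this]; push_cast; ring
  rw [hj', hb']
  field_simp
  ring

/-- The term of index `x`, divided by the eta quotient and the constant in front of it. -/
def cuspTerm {p : ℕ} (r₁ rₚ : ℚ) (L : CuspLift p) (τ : ℍ) (x : CuspPair p) : ℂ :=
  cuspQuotient p r₁ rₚ ((L.toSL x • τ : ℍ) + 1)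

theorem eisOneTerm_eq {p : ℕ} (hp : 0 < p) (r₁ rₚ : ℚ) (L : CuspLift p) (τ : ℍ)
    (x : CuspPair p) :
    eisOneTerm p ((r₁ + rₚ) / 2) r₁ rₚ L τ x =
      eisConst p r₁ rₚ * (etaQuotient p r₁ rₚ τ * cuspTerm r₁ rₚ L τ x) := by
  rw [cuspTerm, CuspLift.coe_toSL_smul, eisOneTerm]
  exact eisTerm_identity hp r₁ rₚ (L.det_eq x) x.2.1 (L.dvd x) (L.pos x) τ.im_pos

/-- The Eisenstein series divided by the eta quotient and the constant in front of it. -/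
def cuspSum {p : ℕ} (r₁ rₚ : ℚ) (L : CuspLift p) (τ : ℍ) : ℂ :=
  ∑' x : CuspPair p, cuspTerm r₁ rₚ L τ x

theorem eisOne_eq {p : ℕ} (hp : 0 < p) (r₁ rₚ : ℚ) (L : CuspLift p) (τ : ℍ) :
    eisOne p ((r₁ + rₚ) / 2) r₁ rₚ L τ =
      eisConst p r₁ rₚ * (etaQuotient p r₁ rₚ τ * cuspSum r₁ rₚ L τ) := by
  rw [eisOne, cuspSum, ← tsum_mul_left, ← tsum_mul_left]
  exact tsum_congr fun x => eisOneTerm_eq hp r₁ rₚ L τ x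

theorem cuspTerm_eq_of_bottom_row {p : ℕ} (hp : 0 < p) {r₁ rₚ : ℚ} (hr : p * r₁ + rₚ = 0)
    (L : CuspLift p) (x : CuspPair p) {γ : SL(2, ℤ)}
    (hrow : (γ 1 0, γ 1 1) = x.1 ∨ (γ 1 0, γ 1 1) = -x.1) (hγ : (p : ℤ) ∣ γ 0 0 + γ 1 0) (τ : ℍ) :
    cuspQuotient p r₁ rₚ ((γ • τ : ℍ) + 1) = cuspTerm r₁ rₚ L τ x := by
  have key : ∀ γ : SL(2, ℤ), (γ 1 0, γ 1 1) = x.1 → (p : ℤ) ∣ γ 0 0 + γ 1 0 →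
      cuspQuotient p r₁ rₚ ((γ • τ : ℍ) + 1) = cuspTerm r₁ rₚ L τ x := by
    intro γ hrow hγ
    obtain ⟨m, hm⟩ := exists_translate_of_bottom_row_eq (p := p) (γ := L.toSL x) (γ' := γ)
      (by rw [Prod.ext_iff] at hrow; simpa [CuspLift.toSL] using hrow.1)
      (by rw [Prod.ext_iff] at hrow; simpa [CuspLift.toSL] using hrow.2)
      (by simpa [CuspLift.toSL] using x.2.1.ne')
      (by simpa [CuspLift.toSL] using x.2.2.2)
      (by simpa [CuspLift.toSL] using L.dvd x) hγ
    rw [cuspTerm, hm, show ((L.toSL x • τ : ℍ) : ℂ) + p * m + 1 =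
      ((L.toSL x • τ : ℍ) : ℂ) + 1 + p * m by ring]
    exact cuspQuotient_add_int_mul hp hr (by simpa using (L.toSL x • τ).im_pos) m
  rcases hrow with hrow | hrow
  · exact key γ hrow hγ
  · rw [← ModularGroup.SL_neg_smul]
    refine key (-γ) ?_ ?_
    · rw [Prod.ext_iff] at hrow ⊢
      simpa [neg_eq_iff_eq_neg] using hrow
    · have : (-γ) 0 0 + (-γ) 1 0 = -(γ 0 0 + γ 1 0) := by
        simp
        ring
      rw [this]
      exact hγ.neg_right

theorem CuspPair.eq_of_eq_or_eq_neg {p : ℕ} {x y : CuspPair p} (h : x.1 = y.1 ∨ x.1 = -y.1) :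
    x = y := by
  rcases h with h | h
  · exact Subtype.ext h
  · have h1 := x.2.1
    have h2 := y.2.1
    rw [h, Prod.fst_neg] at h1
    lia

/-- The right action of matrices on row vectors. -/
def rowMul (σ : SL(2, ℤ)) (x : ℤ × ℤ) : ℤ × ℤ :=
  (x.1 * σ 0 0 + x.2 * σ 1 0, x.1 * σ 0 1 + x.2 * σ 1 1)

theorem rowMul_neg (σ : SL(2, ℤ)) (x : ℤ × ℤ) : rowMul σ (-x) = -rowMul σ x := by
  ext <;> simp [rowMul] <;> ring

theorem rowMul_inv_rowMul (σ : SL(2, ℤ)) (x : ℤ × ℤ) : rowMul σ⁻¹ (rowMul σ x) = x := by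
  have hd := det_eq_one σ
  ext
  · simp [rowMul, Matrix.SpecialLinearGroup.SL2_inv_expl]
    linear_combination x.1 * hd
  · simp [rowMul, Matrix.SpecialLinearGroup.SL2_inv_expl]
    linear_combination x.2 * hd

theorem exists_rowMul {p : ℕ} (hp : p.Prime) {σ : SL(2, ℤ)}
    (hσ : σ ∈ CongruenceSubgroup.Gamma0 p) (x : CuspPair p) :
    ∃ y : CuspPair p, rowMul σ x.1 = y.1 ∨ rowMul σ x.1 = -y.1 := by
  have hd := det_eq_one σ
  obtain ⟨t, ht⟩ : (p : ℤ) ∣ σ 1 0 :=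
    (ZMod.intCast_zmod_eq_zero_iff_dvd _ _).mp (CongruenceSubgroup.Gamma0_mem.mp hσ)
  obtain ⟨⟨c, d⟩, hc, ⟨u, v, huv⟩, ⟨w, z, hwz⟩⟩ := x
  simp only at hc huv hwz
  have h1 : IsCoprime (rowMul σ (c, d)).1 (rowMul σ (c, d)).2 :=
    ⟨u * σ 1 1 - v * σ 0 1, v * σ 0 0 - u * σ 1 0, by
      simp only [rowMul]; linear_combination huv + (u * c + v * d) * hd⟩
  have h2 : IsCoprime (p : ℤ) (rowMul σ (c, d)).1 :=
    ⟨w - z * c * σ 0 1 * t - d * t * z * σ 1 1, z * σ 1 1, by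
      simp only [rowMul]
      linear_combination hwz + z * c * hd + (z * σ 1 1 * d + z * c * σ 0 1) * ht⟩
  have h3 : (rowMul σ (c, d)).1 ≠ 0 := by
    intro h0
    rw [h0, isCoprime_zero_right, Int.isUnit_iff] at h2
    have := hp.two_le
    lia
  rcases lt_or_gt_of_ne h3 with h | h
  · exact ⟨⟨-rowMul σ (c, d), by simpa using h, by simpa using h1.neg_neg, h2.neg_right⟩,
      Or.inr (neg_neg _).symm⟩
  · exact ⟨⟨rowMul σ (c, d), h, h1, h2⟩, Or.inl rfl⟩

theorem exists_rowMul_equiv {p : ℕ} (hp : p.Prime) {σ : SL(2, ℤ)}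
    (hσ : σ ∈ CongruenceSubgroup.Gamma0 p) :
    ∃ φ : CuspPair p ≃ CuspPair p, ∀ x, rowMul σ x.1 = (φ x).1 ∨ rowMul σ x.1 = -(φ x).1 := by
  choose f hf using exists_rowMul hp hσ
  choose g hg using exists_rowMul hp (inv_mem hσ)
  have key : ∀ {σ : SL(2, ℤ)} {f g : CuspPair p → CuspPair p},
      (∀ x, rowMul σ x.1 = (f x).1 ∨ rowMul σ x.1 = -(f x).1) →
      (∀ x, rowMul σ⁻¹ x.1 = (g x).1 ∨ rowMul σ⁻¹ x.1 = -(g x).1) → ∀ x, g (f x) = x := by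
    intro σ f g hf hg x
    have h1 := rowMul_inv_rowMul σ x.1
    refine CuspPair.eq_of_eq_or_eq_neg ?_
    rcases hf x with h | h <;> rcases hg (f x) with h' | h' <;>
      simp only [h, rowMul_neg, h', neg_neg] at h1
    · exact Or.inl h1
    · exact Or.inr (by rw [← h1, neg_neg])
    · exact Or.inr (by rw [← h1, neg_neg])
    · exact Or.inl h1
  exact ⟨⟨f, g, key hf hg, key hg (by rwa [inv_inv])⟩, hf⟩

theorem cuspSum_smul {p : ℕ} (hp : p.Prime) {r₁ rₚ : ℚ} (hr : p * r₁ + rₚ = 0)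
    (L : CuspLift p) {σ : SL(2, ℤ)} (hσ : σ ∈ CongruenceSubgroup.Gamma0 p) (τ : ℍ) :
    cuspSum r₁ rₚ L (σ • τ) = cuspSum r₁ rₚ L τ := by
  obtain ⟨φ, hφ⟩ := exists_rowMul_equiv hp hσ
  obtain ⟨t, ht⟩ : (p : ℤ) ∣ σ 1 0 :=
    (ZMod.intCast_zmod_eq_zero_iff_dvd _ _).mp (CongruenceSubgroup.Gamma0_mem.mp hσ)
  rw [cuspSum, cuspSum, ← φ.tsum_eq (cuspTerm r₁ rₚ L τ)]
  refine tsum_congr fun x => ?_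
  have hrow : ((L.toSL x * σ) 1 0, (L.toSL x * σ) 1 1) = rowMul σ x.1 := by
    rw [mul_apply_eq, mul_apply_eq]
    simp [CuspLift.toSL, rowMul]
  have hdvd : (p : ℤ) ∣ (L.toSL x * σ) 0 0 + (L.toSL x * σ) 1 0 := by
    obtain ⟨s, hs⟩ := L.dvd x
    refine ⟨s * σ 0 0 + (L.b x + x.1.2) * t, ?_⟩
    rw [mul_apply_eq, mul_apply_eq]
    simp [CuspLift.toSL]
    linear_combination σ 0 0 * hs + (L.b x + x.1.2) * ht
  rw [← cuspTerm_eq_of_bottom_row hp.pos hr L (φ x) (γ := L.toSL x * σ)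
    (by rw [hrow]; exact hφ x) hdvd, cuspTerm, smul_smul]

theorem mdifferentiable_cuspSum {p : ℕ} (hp : 0 < p) {r₁ rₚ : ℚ} (hk : 2 < (r₁ + rₚ) / 2)
    (L : CuspLift p) : MDiff (cuspSum r₁ rₚ L) := by
  rw [UpperHalfPlane.mdifferentiable_iff]
  refine ((differentiableOn_eisOne hk r₁ rₚ L).div
    ((differentiableOn_etaQuotient hp r₁ rₚ).const_mul (eisConst p r₁ rₚ)) fun z _ =>
      mul_ne_zero (eisConst_ne_zero _ _ _) (etaQuotient_ne_zero _ _ _ _)).congr fun z hz => ?_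
  have h := eisOne_eq hp r₁ rₚ L ⟨z, hz⟩
  rw [Function.comp_apply, ofComplex_apply_of_im_pos hz, Pi.div_apply, h, ← mul_assoc]
  exact (mul_div_cancel_left₀ _
    (mul_ne_zero (eisConst_ne_zero _ _ _) (etaQuotient_ne_zero _ _ _ _))).symm

theorem qParam_add_one (τ : ℂ) : qParam 1 (1 + τ) = qParam 1 τ := by
  rw [qParam, qParam, exp_eq_exp_iff_exists_int]
  exact ⟨1, by push_cast; ring⟩

theorem cuspSum_vadd_one {p : ℕ} (hp : p.Prime) {r₁ rₚ : ℚ} (hr : p * r₁ + rₚ = 0)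
    (L : CuspLift p) (τ : ℍ) : cuspSum r₁ rₚ L ((1 : ℝ) +ᵥ τ) = cuspSum r₁ rₚ L τ := by
  rw [← modular_T_smul]
  exact cuspSum_smul hp hr L (by rw [CongruenceSubgroup.Gamma0_mem]; simp [ModularGroup.T]) τ

theorem isBoundedAtImInfty_cuspSum {p : ℕ} (hp : p.Prime) {r₁ rₚ : ℚ} (hr : p * r₁ + rₚ = 0)
    (hk : 2 < (r₁ + rₚ) / 2) (hn : (r₁ + p * rₚ) / 24 ≤ 1) (L : CuspLift p) :
    IsBoundedAtImInfty (cuspSum r₁ rₚ L) := by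
  refine isBoundedAtImInfty_of_qParam_mul_tendsto_zero (mdifferentiable_cuspSum hp.pos hk L)
    (cuspSum_vadd_one hp hr L) ?_
  refine tendsto_atImInfty_of_periodic one_pos (fun τ => ?_) ?_
  · rw [cuspSum_vadd_one hp hr L, coe_vadd, ofReal_one, qParam_add_one]
  · have h1 : (fun τ : ℍ => qParam 1 τ / etaQuotient p r₁ rₚ τ)
        =O[atImInfty ⊓ 𝓟 {τ | |τ.re| ≤ 1}] (1 : ℍ → ℝ) :=
      (isBoundedAtImInfty_qParam_div_etaQuotient hp.pos hn).mono inf_le_left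
    have h2 := (Asymptotics.isLittleO_one_iff ℝ).mpr (tendsto_eisOne hk r₁ rₚ L 1)
    have h3 := ((h2.mul_isBigO h1).const_mul_left (eisConst p r₁ rₚ)⁻¹)
    have h4 : (fun τ : ℍ => qParam 1 τ * cuspSum r₁ rₚ L τ) =o[atImInfty ⊓ 𝓟 {τ | |τ.re| ≤ 1}]
        (fun _ => (1 : ℝ)) := by
      refine h3.congr (fun τ => ?_) fun τ => by simp
      rw [eisOne_eq hp.pos]
      have := eisConst_ne_zero p r₁ rₚ
      have := etaQuotient_ne_zero p r₁ rₚ τ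
      field_simp
    exact (Asymptotics.isLittleO_one_iff ℝ).mp h4

theorem coe_S_smul (τ : ℍ) : ((ModularGroup.S • τ : ℍ) : ℂ) = -1 / τ := by
  rw [modular_S_smul]
  show (-(τ : ℂ))⁻¹ = -1 / τ
  rw [neg_div, one_div, inv_neg]

theorem norm_cuspTerm_S_smul {p : ℕ} (hp : 0 < p) (r₁ rₚ : ℚ) (L : CuspLift p) (τ : ℍ)
    (x : CuspPair p) :
    ‖cuspTerm r₁ rₚ L (ModularGroup.S • τ) x‖ = ‖cuspQuotient p r₁ rₚ τ‖ *
      ‖(x.1.2 : ℂ) * τ + (-x.1.1 : ℤ)‖ ^ (-(((r₁ + rₚ) / 2 : ℚ) : ℝ)) := by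
  have h1 := congrArg norm (eisOneTerm_eq hp r₁ rₚ L (ModularGroup.S • τ) x)
  have h2 := norm_etaQuotient_neg_inv hp r₁ rₚ τ.im_pos
  have hτ0 : (τ : ℂ) ≠ 0 := τ.ne_zero
  have hn0 : 0 < ‖(τ : ℂ)‖ := norm_pos_iff.mpr hτ0
  have h3 : (x.1.1 : ℂ) * (-1 / τ) + x.1.2 = ((x.1.2 : ℂ) * τ + (-x.1.1 : ℤ)) / τ := by
    push_cast
    field_simp
    ring
  rw [norm_eisOneTerm, norm_mul, norm_mul, coe_S_smul, h3, norm_div,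
    Real.div_rpow (norm_nonneg _) (norm_nonneg _), Real.rpow_neg hn0.le, div_inv_eq_mul, ← h2] at h1
  have h4 : ‖eisConst p r₁ rₚ‖ ≠ 0 := norm_ne_zero_iff.mpr (eisConst_ne_zero _ _ _)
  have h5 : ‖etaQuotient p r₁ rₚ (-1 / τ)‖ ≠ 0 := norm_ne_zero_iff.mpr (etaQuotient_ne_zero _ _ _ _)
  apply mul_left_cancel₀ (mul_ne_zero h4 h5)
  linear_combination -h1

/-- The pair `(1, 0)`. -/
def CuspPair.oneZero (p : ℕ) : CuspPair p :=
  ⟨(1, 0), one_pos, isCoprime_one_left, isCoprime_one_right⟩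

theorem CuspPair.eq_oneZero {p : ℕ} {x : CuspPair p} (h : x.1.2 = 0) : x = CuspPair.oneZero p := by
  obtain ⟨⟨c, d⟩, hc, hcd, hpc⟩ := x
  simp only at h hc hcd
  subst h
  rw [isCoprime_zero_right, Int.isUnit_iff] at hcd
  have : c = 1 := by lia
  subst this
  rfl

theorem cuspTerm_S_smul_oneZero {p : ℕ} (hp : 0 < p) {r₁ rₚ : ℚ} (hr : p * r₁ + rₚ = 0)
    (L : CuspLift p) (τ : ℍ) :
    cuspTerm r₁ rₚ L (ModularGroup.S • τ) (CuspPair.oneZero p) = cuspQuotient p r₁ rₚ τ := by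
  obtain ⟨m, hm⟩ := L.dvd (CuspPair.oneZero p)
  have hdet := L.det_eq (CuspPair.oneZero p)
  simp only [CuspPair.oneZero, mul_zero, mul_one, zero_sub] at hm hdet
  have hτ0 : (τ : ℂ) ≠ 0 := τ.ne_zero
  rw [cuspTerm, CuspLift.coe_toSL_smul, coe_S_smul, ← cuspQuotient_add_int_mul hp hr τ.im_pos m]
  congr 1
  simp only [CuspPair.oneZero]
  have ha : (L.a ⟨(1, 0), one_pos, isCoprime_one_left, isCoprime_one_right⟩ : ℂ) = p * m - 1 := by
    rw [eq_sub_iff_add_eq]; exact_mod_cast hm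
  have hb : (L.b ⟨(1, 0), one_pos, isCoprime_one_left, isCoprime_one_right⟩ : ℂ) = -1 := by
    rw [← neg_eq_iff_eq_neg]; exact_mod_cast hdet
  rw [ha, hb]
  push_cast
  field_simp
  ring

open Classical in
theorem tendsto_cuspSum_S_smul {p : ℕ} (hp : p.Prime) {r₁ rₚ : ℚ} (hr : p * r₁ + rₚ = 0)
    (hk : 2 < (r₁ + rₚ) / 2) (L : CuspLift p) :
    Tendsto (fun τ => cuspSum r₁ rₚ L (ModularGroup.S • τ)) atImInfty (𝓝 1) := by
  have hk' : (2 : ℝ) < ((r₁ + rₚ) / 2 : ℚ) := by exact_mod_cast hk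
  have hg := tendsto_cuspQuotient hp.pos hr
  refine tendsto_atImInfty_of_periodic (h := p) (by exact_mod_cast hp.pos) (fun τ => ?_) ?_
  · have h1 : ModularGroup.S • ((p : ℝ) +ᵥ τ) = (ModularGroup.S * ModularGroup.T ^ (p : ℤ) *
        ModularGroup.S⁻¹) • ModularGroup.S • τ := by
      have := modular_T_zpow_smul τ p
      rw [Int.cast_natCast] at this
      rw [← this, smul_smul, smul_smul]
      congr 1
      group
    rw [h1]
    refine cuspSum_smul hp hr L ?_ _
    rw [CongruenceSubgroup.Gamma0_mem, mul_apply_eq, mul_apply_eq, mul_apply_eq,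
      Matrix.SpecialLinearGroup.SL2_inv_expl, ModularGroup.coe_T_zpow]
    simp [ModularGroup.S]
  · rw [← tsum_ite_eq (CuspPair.oneZero p) (fun _ => (1 : ℂ))]
    refine tendsto_tsum_of_dominated_convergence (((summable_cuspPair p hk').mul_left
      (EisensteinSeries.r ⟨⟨p, 1⟩, one_pos⟩ ^ (-(((r₁ + rₚ) / 2 : ℚ) : ℝ)))).mul_left 2) ?_ ?_
    · intro x
      refine Tendsto.mono_left ?_ (inf_le_left : _ ≤ atImInfty)
      split_ifs with hx
      · subst hx
        simpa only [cuspTerm_S_smul_oneZero hp.pos hr] using hg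
      · rw [tendsto_zero_iff_norm_tendsto_zero]
        simp only [norm_cuspTerm_S_smul hp.pos]
        have := hg.norm.mul (tendsto_norm_linear_rpow (k := (((r₁ + rₚ) / 2 : ℚ) : ℝ))
          (by linarith) (fun h => hx (CuspPair.eq_oneZero h)) (-x.1.1))
        rwa [mul_zero] at this
    · have h2 : ∀ᶠ τ : ℍ in atImInfty, ‖cuspQuotient p r₁ rₚ τ‖ ≤ 2 :=
        hg.norm.eventually (Iic_mem_nhds (by simp))
      filter_upwards [eventually_mem_verticalStrip p, mem_inf_of_left h2] with τ hτ hτ2 x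
      rw [norm_cuspTerm_S_smul hp.pos]
      refine mul_le_mul hτ2 ?_ (by positivity) zero_le_two
      have h3 := norm_linear_rpow_le (k := (((r₁ + rₚ) / 2 : ℚ) : ℝ)) (by linarith)
        x.1.2 (-x.1.1) one_pos hτ
      rwa [EisensteinSeries.norm_symm, show ‖![-x.1.1, x.1.2]‖ = ‖![x.1.1, x.1.2]‖ by
        simp [EisensteinSeries.norm_eq_max_natAbs]] at h3

/-- The Eisenstein series at the cusp `1` is an eta quotient, whenever that eta quotient does not
vanish at the cusp `1` and vanishes to order at most one at `∞`. -/
theorem eisOne_eq_etaQuotient {p : ℕ} (hp : p.Prime) {r₁ rₚ : ℚ} (hr : p * r₁ + rₚ = 0)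
    (hk : 2 < (r₁ + rₚ) / 2) (hn : (r₁ + p * rₚ) / 24 ≤ 1) (L : CuspLift p) (τ : ℍ) :
    eisOne p ((r₁ + rₚ) / 2) r₁ rₚ L τ = eisConst p r₁ rₚ * etaQuotient p r₁ rₚ τ := by
  have : Fact p.Prime := ⟨hp⟩
  rw [eisOne_eq hp.pos, eq_of_Gamma0_invariant (mdifferentiable_cuspSum hp.pos hk L)
    (fun σ hσ => cuspSum_smul hp hr L hσ) (isBoundedAtImInfty_cuspSum hp hr hk hn L)
    (tendsto_cuspSum_S_smul hp hr hk L), mul_one]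

end RatEis

end

theorem theorem7p2 (n : ℚ) :
    (1 / 2 < n → n ≤ 1 → ∀ (L : RatEis.CuspLift 2) (τ : UpperHalfPlane),
      Summable (RatEis.eisOneTerm 2 (4 * n) (-8 * n) (16 * n) L τ) ∧
      RatEis.eisOne 2 (4 * n) (-8 * n) (16 * n) L τ =
        (2 : ℂ) ^ (8 * n : ℂ) *
          (RatEis.etaPow (-8 * n) τ * RatEis.etaPow (16 * n) (2 * (τ : ℂ)))) ∧
    (2 / 3 < n → n ≤ 1 → ∀ (L : RatEis.CuspLift 3) (τ : UpperHalfPlane),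
      Summable (RatEis.eisOneTerm 3 (3 * n) (-3 * n) (9 * n) L τ) ∧
      RatEis.eisOne 3 (3 * n) (-3 * n) (9 * n) L τ =
        (3 : ℂ) ^ (9 * n / 2 : ℂ) * RatEis.e (-(n : ℂ) / 4) *
          (RatEis.etaPow (-3 * n) τ * RatEis.etaPow (9 * n) (3 * (τ : ℂ)))) := by
  constructor
  · intro h1 h2 L τ
    refine ⟨RatEis.summable_eisOneTerm (by linarith) _ _ L τ, ?_⟩
    have h := RatEis.eisOne_eq_etaQuotient (p := 2) Nat.prime_two (r₁ := -8 * n) (rₚ := 16 * n)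
      (by push_cast; ring) (by linarith) (by push_cast; linarith) L τ
    rw [show (-8 * n + 16 * n) / 2 = 4 * n by ring] at h
    rw [h, RatEis.etaQuotient, RatEis.eisConst, Complex.cpow_def_of_ne_zero two_ne_zero,
      Complex.ofReal_log (by norm_num)]
    push_cast
    ring_nf
  · intro h1 h2 L τ
    refine ⟨RatEis.summable_eisOneTerm (by linarith) _ _ L τ, ?_⟩
    have h := RatEis.eisOne_eq_etaQuotient (p := 3) Nat.prime_three (r₁ := -3 * n) (rₚ := 9 * n)
      (by push_cast; ring) (by linarith) (by push_cast; linarith) L τ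
    rw [show (-3 * n + 9 * n) / 2 = 3 * n by ring] at h
    rw [h, RatEis.etaQuotient, RatEis.eisConst, Complex.cpow_def_of_ne_zero three_ne_zero,
      Complex.ofReal_log (by norm_num), RatEis.e, ← Complex.exp_add]
    push_cast
    ring_nf
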